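/- **Setting.** Let $k_1,k_2,C\in\mathbb C$ with $C\ne 0$ and $C^2=k_1k_2$, and let $J=\begin{pmatrix}0&k_1\\k_2&0\end{pmatrix}$, so that $J^2=\Delta^2 I$ with $\Delta\equiv C$. For $f:\mathbb R\to\mathbb C$ put $K(t)=I+f(t)J$. Let $r$ and $\theta$ be the continuous functions on $\mathbb R$ with $$r^2=1-C^2f^2,\qquad e^{2C\theta}=\frac{1+Cf}{1-Cf},\qquad r(t)\to1,\ \ \theta(t)\to0\quad (t\to+\infty),$$ that is, $r=\sqrt{1-C^2f^2}$ and $\theta=\frac1{2C}\ln\frac{1+Cf}{1-Cf}$. Let $r=r_+r_-$ and $\theta=\theta_++\theta_-$, where $r_\pm,\theta_\pm$ are the boundary values of functions analytic in the open upper ($+$) or lower ($-$) half-plane and continuous on the closed half-plane, such that at infinity in the closed half-plane the extensions of $r_\pm$ tend to $1$ and those of $\theta_\pm$ tend to $0$, and the extensions of $r_\pm$ have no zero in the closed half-plane. We call $(r,\theta,r_\pm,\theta_\pm)$ *scalar factors* of $f$, and put $$K_\pm=r_\pm\Big(\cosh(C\theta_\pm)\,I+\tfrac1C\sinh(C\theta_\pm)\,J\Big).$$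 The same notation with a tilde is used for a second function $\tilde f$ and $\tilde K=I+\tilde fJ$. The norm $\|\cdot\|_2$ is that of $L_2(\mathbb R)$, with the Frobenius norm on matrices. The index of a continuous non-vanishing function $g$ on $\mathbb R$ is $\frac1{2\pi}\big(\lim_{t\to+\infty}\arg g-\lim_{t\to-\infty}\arg g\big)$ for a continuous branch of $\arg g$. **Theorem.** Let $\alpha>0$, $H\ge0$, $N\in\mathbb R$ and $m,d,L>0$. There is $\varepsilon_0>0$, depending only on $k_1,k_2,C,\alpha,H,m,N,d,L$, such that the following holds for all $0<\varepsilon<\varepsilon_0$ and all $f,\tilde f:\mathbb R\to\mathbb C$ that are Hölder continuous with exponent $\alpha$ and constant $H$ and tend to $0$ at $\pm\infty$. Suppose that $1-C^2f^2$ and $\frac{1-Cf}{1+Cf}$ have index zero, that on $\mathbb R$ $$|Cf|,|C\tilde f|\le N,\qquad |1+Cf|,|1+C\tilde f|\ge d,\qquad \Big|\tfrac{1-Cf}{1+Cf}\Big|,\Big|\tfrac{1-C\tilde f}{1+C\tilde f}\Big|\ge L,$$ and that $\|\Delta f-\Delta\tilde f\|_2<\varepsilon$. Then: 1. If $f\in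 L_2(\mathbb R)$, then scalar factors of $f$ and of $\tilde f$ exist. 2. For all scalar factors of $f$ and of $\tilde f$ with $|r|,|\tilde r|\ge m$ on $\mathbb R$: * $K=K_+K_-$ and $\tilde K=\tilde K_+\tilde K_-$ on $\mathbb R$; * there are finite $R,E$ with $|r_\pm|,|\tilde r_\pm|\le R$ and $\cosh(\operatorname{Re}C\theta_\pm),\cosh(\operatorname{Re}C\tilde\theta_\pm)\le E$ on $\mathbb R$ (so $E$ bounds the moduli of $\cosh(C\theta_\pm)$, $\sinh(C\theta_\pm)$, $\cosh(C\tilde\theta_\pm)$, $\sinh(C\tilde\theta_\pm)$); * $\|\theta_\pm-\tilde\theta_\pm\|_2\le\dfrac{2}{|C|d^2L}\,\varepsilon$; * for all such $R$ and $E$, $$\|r_\pm-\tilde r_\pm\|_2\le\frac{5RN}{m^2}\,\varepsilon,$$ $$\|K_\pm-\tilde K_\pm\|_2\le\sqrt{2+\frac{|k_1|^2+|k_2|^2}{|C|^2}}\;E\left(R\,|C|\,\frac{2}{|C|d^2L}+\frac{5RN}{m^2}\right)\varepsilon .$$ -/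

import Mathlib

open Filter Topology MeasureTheory
open scoped NNReal ENNReal

noncomputable section

namespace DanieleKhrapkov

/-- `g` is a continuous non-vanishing function on the real line whose index
`(1 / 2π) (lim_{t → +∞} arg g - lim_{t → -∞} arg g)` exists and equals `κ`;
here `arg g` is a continuous branch of the argument. -/
def HasIndex (g : ℝ → ℂ) (κ : ℝ) : Prop :=
  Continuous g ∧ (∀ t, g t ≠ 0) ∧
    ∃ φ : ℝ → ℝ, Continuous φ ∧
      (∀ t, g t = (‖g t‖ : ℂ) * Complex.exp ((φ t : ℂ) * Complex.I)) ∧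
      ∃ a b : ℝ, Tendsto φ atTop (𝓝 a) ∧ Tendsto φ atBot (𝓝 b) ∧
        1 / (2 * Real.pi) * (a - b) = κ

/-- The open upper half-plane, as a subset of the complex plane. -/
def upper : Set ℂ := {z | 0 < z.im}

/-- The open lower half-plane, as a subset of the complex plane. -/
def lower : Set ℂ := {z | z.im < 0}

/-- `G` extends `g : ℝ → ℂ` analytically to the half-plane `U` (`upper` or `lower`):
it is analytic in `U`, continuous up to the real line, where it equals `g`, and tends to `w`
at infinity in the closed half-plane. -/
structure IsExtension (U : Set ℂ) (g : ℝ → ℂ) (w : ℂ) (G : ℂ → ℂ) : Prop where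
  analytic : DifferentiableOn ℂ G U
  continuous : ContinuousOn G (closure U)
  limit : Tendsto G (cocompact ℂ ⊓ 𝓟 (closure U)) (𝓝 w)
  boundary : ∀ t : ℝ, G (t : ℂ) = g t

/-- Additive splitting `F = Fp + Fm`, normalised by `Fp, Fm → 0` at infinity. -/
structure IsAdditiveSplitting (F Fp Fm : ℝ → ℂ) : Prop where
  eq_add : ∀ t, F t = Fp t + Fm t
  plus : ∃ G, IsExtension upper Fp 0 G
  minus : ∃ G, IsExtension lower Fm 0 G

/-- Scalar Wiener--Hopf factorisation `F = Fp * Fm` with factors analytic and non-zero in the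
upper and lower half-plane, normalised by `Fp, Fm → 1` at infinity. -/
structure IsWienerHopf (F Fp Fm : ℝ → ℂ) : Prop where
  eq_mul : ∀ t, F t = Fp t * Fm t
  plus : ∃ G, IsExtension upper Fp 1 G ∧ ∀ z ∈ closure upper, G z ≠ 0
  minus : ∃ G, IsExtension lower Fm 1 G ∧ ∀ z ∈ closure lower, G z ≠ 0

/-- The scalar functions from which the factors of `I + f J`, `J² = C² I`, are formed: the
continuous branches `r = √(1 - C² f²)` and `θ = (1 / (2 C)) ln ((1 + C f) / (1 - C f))` with
`r → 1`, `θ → 0` at `+∞`, the factorisation `r = r₊ r₋` and the splitting `θ = θ₊ + θ₋`. -/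
structure ScalarFactors (C : ℂ) (f : ℝ → ℂ) where
  /-- the branch of the square root -/
  r : ℝ → ℂ
  /-- the branch of the logarithm -/
  θ : ℝ → ℂ
  /-- the factor `r₊` -/
  rp : ℝ → ℂ
  /-- the factor `r₋` -/
  rm : ℝ → ℂ
  /-- the summand `θ₊` -/
  θp : ℝ → ℂ
  /-- the summand `θ₋` -/
  θm : ℝ → ℂ
  r_continuous : Continuous r
  r_sq : ∀ t, r t ^ 2 = 1 - C ^ 2 * f t ^ 2
  r_limit : Tendsto r atTop (𝓝 1)
  θ_continuous : Continuous θ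
  exp_θ : ∀ t, Complex.exp (2 * C * θ t) = (1 + C * f t) / (1 - C * f t)
  θ_limit : Tendsto θ atTop (𝓝 0)
  r_factors : IsWienerHopf r rp rm
  θ_parts : IsAdditiveSplitting θ θp θm

/-- The constant matrix `J` with zero diagonal. -/
def offDiag (k₁ k₂ : ℂ) : Matrix (Fin 2) (Fin 2) ℂ := !![0, k₁; k₂, 0]

/-- The Daniele--Khrapkov matrix function `K = I + f J` with constant `J`. -/
def dkMatrix (J : Matrix (Fin 2) (Fin 2) ℂ) (f : ℝ → ℂ) (t : ℝ) : Matrix (Fin 2) (Fin 2) ℂ :=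
  1 + f t • J

/-- `ρ (cosh (C ϑ) I + C⁻¹ sinh (C ϑ) J)`, the form of the Daniele--Khrapkov factors. -/
def dkFactor (C : ℂ) (J : Matrix (Fin 2) (Fin 2) ℂ) (ρ ϑ : ℝ → ℂ) (t : ℝ) :
    Matrix (Fin 2) (Fin 2) ℂ :=
  ρ t • (Complex.cosh (C * ϑ t) • (1 : Matrix (Fin 2) (Fin 2) ℂ)
    + (1 / C * Complex.sinh (C * ϑ t)) • J)

/-- The factor `K₊`. -/
def ScalarFactors.Kp {C : ℂ} {f : ℝ → ℂ} (F : ScalarFactors C f)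
    (J : Matrix (Fin 2) (Fin 2) ℂ) : ℝ → Matrix (Fin 2) (Fin 2) ℂ := dkFactor C J F.rp F.θp

/-- The factor `K₋`. -/
def ScalarFactors.Km {C : ℂ} {f : ℝ → ℂ} (F : ScalarFactors C f)
    (J : Matrix (Fin 2) (Fin 2) ℂ) : ℝ → Matrix (Fin 2) (Fin 2) ℂ := dkFactor C J F.rm F.θm

/-- The `L₂(ℝ)` norm of a scalar function. -/
def L2norm (g : ℝ → ℂ) : ℝ≥0∞ := eLpNorm g 2 volume

/-- The `L₂(ℝ)` norm of a matrix function, for the Frobenius norm on matrices. -/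
def matL2norm (A : ℝ → Matrix (Fin 2) (Fin 2) ℂ) : ℝ≥0∞ :=
  (∑ i, ∑ j, L2norm (fun t => A t i j) ^ 2) ^ (1 / 2 : ℝ)

/-- `R` bounds `|r₊|` and `|r₋|` on the real line. -/
def ScalarFactors.BoundR {C : ℂ} {f : ℝ → ℂ} (F : ScalarFactors C f) (R : ℝ) : Prop :=
  ∀ t, ‖F.rp t‖ ≤ R ∧ ‖F.rm t‖ ≤ R

/-- `E` bounds `cosh (Re (C θ₊))` and `cosh (Re (C θ₋))`, hence also the moduli of
`cosh (C θ₊)`, `sinh (C θ₊)`, `cosh (C θ₋)`, `sinh (C θ₋)`, on the real line. -/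
def ScalarFactors.BoundE {C : ℂ} {f : ℝ → ℂ} (F : ScalarFactors C f) (E : ℝ) : Prop :=
  ∀ t, Real.cosh (C * F.θp t).re ≤ E ∧ Real.cosh (C * F.θm t).re ≤ E

end DanieleKhrapkov

end

namespace DanieleKhrapkov

/-! ### Half-planes -/

/-! Since J² = C² I, the matrix cosh(Cϑ) I + C⁻¹ sinh(Cϑ) J is exp(ϑJ), and all such matrices
commute. The addition theorems therefore reduce K = K₊K₋ to the scalar identities r cosh(Cθ) = 1 and
r sinh(Cθ) = Cf (`ScalarFactors.r_mul_cosh`, `ScalarFactors.r_mul_sinh`).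

For the estimates, a difference of two functions with a fixed Hölder constant that is small in L₂ is
uniformly small (`exists_norm_sub_le_of_L2norm_lt`); this supplies ε₀. Then exp(2C(θ - θ̃)) and
r²/r̃² stay within 1/2 of 1. Their exponents are continuous and tend to 0, so by connectedness they
stay on the principal branch (`norm_le_of_norm_exp_sub_one_le`), and θ - θ̃ and log r - log r̃ are
bounded pointwise by multiples of |Cf - Cf̃|. Passing to the ± parts costs nothing: boundary values
from opposite half-planes are orthogonal in L₂ (`IsAdditiveSplitting.L2norm_plus_le`). For r± this
needs logarithms on the whole half-plane (`IsExtension.exists_log`). Mean-value bounds for exp, cosh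
and sinh then give r± and K±.

For existence, index zero gives logarithms of 1 - C²f² and (1 - Cf)/(1 + Cf) that vanish at
infinity. They are Hölder continuous and lie in L₂, so their Cauchy transforms split them additively
(`exists_isAdditiveSplitting`); exponentiating the splitting of ½ log(1 - C²f²) gives r±. For f̃ the
logarithms come from those of f by closeness (`exists_log_of_close`). -/

theorem closure_upper : closure upper = {z : ℂ | 0 ≤ z.im} :=
  Complex.closure_setOfPred_lt_im 0

theorem closure_lower : closure lower = {z : ℂ | z.im ≤ 0} :=
  Complex.closure_setOfPred_im_lt 0

theorem mem_upper {z : ℂ} : z ∈ upper ↔ 0 < z.im := Iff.rfl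

theorem mem_lower {z : ℂ} : z ∈ lower ↔ z.im < 0 := Iff.rfl

theorem mem_closure_upper {z : ℂ} : z ∈ closure upper ↔ 0 ≤ z.im := by
  rw [closure_upper]; rfl

theorem mem_closure_lower {z : ℂ} : z ∈ closure lower ↔ z.im ≤ 0 := by
  rw [closure_lower]; rfl

theorem isOpen_upper : IsOpen upper := isOpen_lt continuous_const Complex.continuous_im

theorem ofReal_mem_closure_upper (t : ℝ) : (t : ℂ) ∈ closure upper := by
  simp [mem_closure_upper]

theorem ofReal_mem_closure_lower (t : ℝ) : (t : ℂ) ∈ closure lower := by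
  simp [mem_closure_lower]

/-- Reflection `z ↦ -z` turns extensions to the lower half-plane into extensions to the upper
half-plane. -/
theorem IsExtension.reflect {g : ℝ → ℂ} {w : ℂ} {G : ℂ → ℂ} (h : IsExtension lower g w G) :
    IsExtension upper (fun t => g (-t)) w (fun z => G (-z)) where
  analytic := h.analytic.comp differentiable_neg.differentiableOn
    fun z hz => by simpa [mem_lower, mem_upper] using hz
  continuous := h.continuous.comp continuous_neg.continuousOn
    fun z hz => by simpa [mem_closure_lower, mem_closure_upper] using hz
  limit := h.limit.comp <| by
    refine tendsto_inf.2 ⟨((Homeomorph.neg ℂ).isClosedEmbedding.tendsto_cocompact).mono_left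
      inf_le_left, tendsto_principal.2 ?_⟩
    filter_upwards [mem_inf_of_right (mem_principal_self _)] with z hz
    simpa [mem_closure_lower, mem_closure_upper] using hz
  boundary t := by simpa using h.boundary (-t)

/-- Reflection `z ↦ -z` turns extensions to the upper half-plane into extensions to the lower
half-plane. -/
theorem IsExtension.reflect' {g : ℝ → ℂ} {w : ℂ} {G : ℂ → ℂ} (h : IsExtension upper g w G) :
    IsExtension lower (fun t => g (-t)) w (fun z => G (-z)) where
  analytic := h.analytic.comp differentiable_neg.differentiableOn
    fun z hz => by simpa [mem_lower, mem_upper] using hz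
  continuous := h.continuous.comp continuous_neg.continuousOn
    fun z hz => by simpa [mem_closure_lower, mem_closure_upper] using hz
  limit := h.limit.comp <| by
    refine tendsto_inf.2 ⟨((Homeomorph.neg ℂ).isClosedEmbedding.tendsto_cocompact).mono_left
      inf_le_left, tendsto_principal.2 ?_⟩
    filter_upwards [mem_inf_of_right (mem_principal_self _)] with z hz
    simpa [mem_closure_lower, mem_closure_upper] using hz
  boundary t := by simpa using h.boundary (-t)

theorem IsExtension.sub {U : Set ℂ} {g g' : ℝ → ℂ} {w w' : ℂ} {G G' : ℂ → ℂ}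
    (h : IsExtension U g w G) (h' : IsExtension U g' w' G') :
    IsExtension U (fun t => g t - g' t) (w - w') (fun z => G z - G' z) where
  analytic := h.analytic.sub h'.analytic
  continuous := h.continuous.sub h'.continuous
  limit := h.limit.sub h'.limit
  boundary t := by rw [h.boundary, h'.boundary]

theorem IsAdditiveSplitting.sub {F Fp Fm F' Fp' Fm' : ℝ → ℂ} (h : IsAdditiveSplitting F Fp Fm)
    (h' : IsAdditiveSplitting F' Fp' Fm') :
    IsAdditiveSplitting (fun t => F t - F' t) (fun t => Fp t - Fp' t) (fun t => Fm t - Fm' t) where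
  eq_add t := by rw [h.eq_add, h'.eq_add]; ring
  plus := by
    obtain ⟨G, hG⟩ := h.plus
    obtain ⟨G', hG'⟩ := h'.plus
    exact ⟨_, by simpa using hG.sub hG'⟩
  minus := by
    obtain ⟨G, hG⟩ := h.minus
    obtain ⟨G', hG'⟩ := h'.minus
    exact ⟨_, by simpa using hG.sub hG'⟩

theorem IsAdditiveSplitting.reflect {F Fp Fm : ℝ → ℂ} (h : IsAdditiveSplitting F Fp Fm) :
    IsAdditiveSplitting (fun t => F (-t)) (fun t => Fm (-t)) (fun t => Fp (-t)) where
  eq_add t := by rw [h.eq_add, add_comm]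
  plus := let ⟨_, hG⟩ := h.minus; ⟨_, hG.reflect⟩
  minus := let ⟨_, hG⟩ := h.plus; ⟨_, hG.reflect'⟩

/-! ### Boundedness and contour integration -/

theorem exists_norm_le_of_tendsto {X : Type*} [TopologicalSpace X] {S : Set X} (hS : IsClosed S)
    {G : X → ℂ} {w : ℂ} (hc : ContinuousOn G S) (hl : Tendsto G (cocompact X ⊓ 𝓟 S) (𝓝 w)) :
    ∃ M, 0 ≤ M ∧ ∀ z ∈ S, ‖G z‖ ≤ M := by
  have h1 : ∀ᶠ z in cocompact X ⊓ 𝓟 S, ‖G z‖ < ‖w‖ + 1 :=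
    hl.norm.eventually (gt_mem_nhds (lt_add_one _))
  rw [eventually_inf_principal] at h1
  obtain ⟨K, hK, hKs⟩ := mem_cocompact.1 h1
  obtain ⟨M, hM⟩ := (hK.inter_right hS).exists_bound_of_continuousOn
    (hc.mono Set.inter_subset_right)
  refine ⟨max M (‖w‖ + 1), le_max_of_le_right (by positivity), fun z hz => ?_⟩
  by_cases hzK : z ∈ K
  · exact (hM z ⟨hzK, hz⟩).trans (le_max_left _ _)
  · exact (hKs hzK hz).le.trans (le_max_right _ _)

theorem IsExtension.exists_norm_le {U : Set ℂ} {g : ℝ → ℂ} {w : ℂ} {G : ℂ → ℂ}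
    (h : IsExtension U g w G) : ∃ M, 0 ≤ M ∧ ∀ z ∈ closure U, ‖G z‖ ≤ M :=
  exists_norm_le_of_tendsto isClosed_closure h.continuous h.limit

theorem integrable_ofReal_of_decay {E : Type*} [NormedAddCommGroup E] {u : ℝ → E}
    (hc : Continuous u) {M : ℝ} (hM : ∀ t, ‖u t‖ * (1 + t ^ 2) ≤ M) : Integrable u := by
  refine (integrable_inv_one_add_sq.const_mul M).mono' hc.aestronglyMeasurable
    (Eventually.of_forall fun t => ?_)
  rw [← div_eq_mul_inv, le_div_iff₀ (by positivity)]
  exact hM t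

theorem continuous_comp_ofReal {h : ℂ → ℂ} (hc : ContinuousOn h (closure upper)) :
    Continuous fun t : ℝ => h t :=
  hc.comp_continuous Complex.continuous_ofReal ofReal_mem_closure_upper

/-- Cauchy's theorem in the upper half-plane for functions of quadratic decay. -/
theorem integral_ofReal_eq_zero {h : ℂ → ℂ} (hd : DifferentiableOn ℂ h upper)
    (hc : ContinuousOn h (closure upper)) {M : ℝ}
    (hM : ∀ z ∈ closure upper, ‖h z‖ * (1 + ‖z‖ ^ 2) ≤ M) : ∫ t : ℝ, h t = 0 := by
  have hi : Integrable fun t : ℝ => h t := integrable_ofReal_of_decay (continuous_comp_ofReal hc)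
    (M := M) fun t => by simpa using hM t (ofReal_mem_closure_upper t)
  have hlim := intervalIntegral_tendsto_integral hi tendsto_neg_atTop_atBot tendsto_id
  -- The contour is the rectangle with vertices ±T and ±T + iT. Off the real side its length is 4T,
  -- and there |h| ≤ M/T², whence the bound 4M/T.
  refine tendsto_nhds_unique hlim (squeeze_zero_norm' (a := fun T : ℝ => 4 * M / T) ?_
    (tendsto_const_nhds.div_atTop tendsto_id))
  filter_upwards [eventually_gt_atTop 0] with T hT
  have hb : ∀ z ∈ closure upper, T ≤ ‖z‖ → ‖h z‖ ≤ M / T ^ 2 := fun z hz hTz => by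
    rw [le_div_iff₀ (by positivity)]
    refine le_trans ?_ (hM z hz)
    gcongr
    nlinarith
  have key := Complex.integral_boundary_rect_eq_zero_of_continuousOn_of_differentiableOn h
    (-T : ℂ) (T + T * Complex.I)
    (hc.mono fun z hz => by
      have h1 := hz.2
      simp only [Set.mem_preimage] at h1
      rw [mem_closure_upper]
      have := h1.1
      simp at this
      cases this <;> linarith)
    (hd.mono fun z hz => by
      have h1 := hz.2.1
      simp at h1
      rw [mem_upper]
      cases h1 <;> linarith)
  simp only [Complex.neg_re, Complex.ofReal_re, Complex.add_re, Complex.mul_re, Complex.I_re,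
    mul_zero, Complex.ofReal_im, Complex.I_im, mul_one, sub_self, add_zero, Complex.neg_im,
    neg_zero, Complex.ofReal_zero, zero_mul, Complex.add_im, Complex.mul_im, zero_add,
    smul_eq_mul] at key
  have e1 : ‖∫ x in (-T)..T, h (x + T * Complex.I)‖ ≤ M / T ^ 2 * |T - -T| :=
    intervalIntegral.norm_integral_le_of_norm_le_const fun x _ => hb _
      (by simp [mem_closure_upper, hT.le])
      (by simpa [abs_of_pos hT] using Complex.abs_im_le_norm (x + T * Complex.I))
  have e2 : ∀ s : ℝ, |s| = T → ‖∫ y in (0 : ℝ)..T, h (s + y * Complex.I)‖ ≤ M / T ^ 2 * |T - 0| :=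
    fun s hs => intervalIntegral.norm_integral_le_of_norm_le_const fun y hy => hb _
      (by
        rw [Set.uIoc_of_le hT.le] at hy
        simpa [mem_closure_upper] using hy.1.le)
      (by simpa [hs] using Complex.abs_re_le_norm (s + y * Complex.I))
  have e3 := e2 T (abs_of_pos hT)
  have e4 := e2 (-T) (by rw [abs_neg, abs_of_pos hT])
  rw [sub_neg_eq_add, abs_of_pos (by linarith)] at e1
  rw [sub_zero, abs_of_pos hT] at e3 e4
  have e5 : (∫ x in (-T)..T, h x) = (∫ x in (-T)..T, h (x + T * Complex.I))
      - Complex.I * (∫ y in (0 : ℝ)..T, h (T + y * Complex.I))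
      + Complex.I * (∫ y in (0 : ℝ)..T, h ((-T : ℝ) + y * Complex.I)) := by
    linear_combination key
  simp only [id]
  rw [e5]
  refine (norm_add_le _ _).trans ((add_le_add (norm_sub_le _ _) le_rfl).trans ?_)
  rw [norm_mul, norm_mul, Complex.norm_I, one_mul, one_mul]
  have e6 : M / T ^ 2 * (T + T) + M / T ^ 2 * T + M / T ^ 2 * T = 4 * M / T := by
    field_simp; ring
  linarith

/-! ### The orthogonal projections onto the Hardy spaces -/

/-- On the ball of radius 2‖p‖ + 1 compactness suffices; outside it, 1 + ‖z‖ ≤ 2‖z - p‖. The point p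
may lie in S, which is what a difference quotient with a removed singularity needs. -/
theorem exists_decay_of_mul_sub {S : Set ℂ} (hS : IsClosed S) {k : ℂ → ℂ} (hc : ContinuousOn k S)
    {p : ℂ} {M : ℝ} (hM : ∀ z ∈ S, ‖k z‖ * ‖z - p‖ ≤ M) :
    ∃ M', 0 ≤ M' ∧ ∀ z ∈ S, ‖k z‖ * (1 + ‖z‖) ≤ M' := by
  obtain ⟨M₁, hM₁⟩ := ((isCompact_closedBall (0 : ℂ) (2 * ‖p‖ + 1)).inter_right
    hS).exists_bound_of_continuousOn (hc.mono Set.inter_subset_right)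
  refine ⟨max 0 (max (M₁ * (2 * ‖p‖ + 2)) (2 * M)), le_max_left _ _, fun z hz => ?_⟩
  rcases le_total ‖z‖ (2 * ‖p‖ + 1) with h | h
  · refine le_trans ?_ ((le_max_left _ _).trans (le_max_right _ _))
    have h1 := hM₁ z ⟨by simpa using h, hz⟩
    exact mul_le_mul h1 (by linarith) (by positivity) ((norm_nonneg _).trans h1)
  · refine le_trans ?_ ((le_max_right _ _).trans (le_max_right _ _))
    have h1 := hM z hz
    have h2 := norm_sub_norm_le z p
    have h3 : ‖k z‖ * (1 + ‖z‖) ≤ ‖k z‖ * (2 * ‖z - p‖) := by gcongr; linarith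
    linarith

theorem memLp_two_of_decay {a : ℝ → ℂ} (hc : Continuous a) {M : ℝ}
    (hM : ∀ t : ℝ, ‖a t‖ * (1 + |t|) ≤ M) : MemLp a 2 volume := by
  rw [memLp_two_iff_integrable_sq_norm hc.aestronglyMeasurable]
  refine integrable_ofReal_of_decay (M := M ^ 2) (by fun_prop) fun t => ?_
  have h2 : (‖a t‖ * (1 + |t|)) ^ 2 ≤ M ^ 2 := by gcongr; exact hM t
  rw [Real.norm_of_nonneg (by positivity)]
  refine le_trans ?_ h2
  rw [mul_pow]
  gcongr
  nlinarith [sq_abs t, abs_nonneg t]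

/-- Pythagoras: the hypothesis says that a is orthogonal to the conjugate of b. -/
theorem L2norm_le_of_integral_mul_eq_zero {a b : ℝ → ℂ} (ha : MemLp a 2 volume)
    (hb : MemLp b 2 volume) (hab : ∫ t, a t * b t = 0) :
    L2norm a ≤ L2norm fun t => a t + (starRingEnd ℂ) (b t) := by
  have hs : MemLp (fun t => a t + (starRingEnd ℂ) (b t)) 2 volume := ha.add hb.star
  rw [L2norm, L2norm, ha.eLpNorm_eq_integral_rpow_norm two_ne_zero ENNReal.ofNat_ne_top,
    hs.eLpNorm_eq_integral_rpow_norm two_ne_zero ENNReal.ofNat_ne_top]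
  simp only [ENNReal.toReal_ofNat, Real.rpow_ofNat]
  refine ENNReal.ofReal_le_ofReal (Real.rpow_le_rpow (integral_nonneg fun _ => by positivity) ?_
    (by norm_num))
  have ia := ha.integrable_norm_pow two_ne_zero
  have ib := hb.integrable_norm_pow two_ne_zero
  have iab : Integrable fun t => a t * b t := ha.integrable_mul hb
  have e : ∀ t, ‖a t + (starRingEnd ℂ) (b t)‖ ^ 2
      = ‖a t‖ ^ 2 + ‖b t‖ ^ 2 + 2 * (a t * b t).re := fun t => by
    rw [Complex.sq_norm, Complex.normSq_add, Complex.normSq_conj, Complex.conj_conj,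
      Complex.sq_norm, Complex.sq_norm]
  have hre : ∫ t, (a t * b t).re = 0 := by
    have := integral_re iab
    simp only [RCLike.re_to_complex] at this
    rw [this, hab, Complex.zero_re]
  simp_rw [e]
  have e' : ∫ t, (‖a t‖ ^ 2 + ‖b t‖ ^ 2 + 2 * (a t * b t).re)
      = (∫ t, ‖a t‖ ^ 2) + (∫ t, ‖b t‖ ^ 2) + 2 * ∫ t, (a t * b t).re := by
    rw [← integral_const_mul, ← integral_add ia ib]
    exact integral_add (ia.add ib) (iab.re.const_mul 2)
  rw [e', hre]
  have : 0 ≤ ∫ t, ‖b t‖ ^ 2 := integral_nonneg fun _ => by positivity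
  linarith

theorem norm_one_sub_I_mul_ge {δ : ℝ} (hδ : 0 < δ) {z : ℂ} (hz : 0 ≤ z.im) :
    1 ≤ ‖1 - Complex.I * δ * z‖ := by
  have := Complex.abs_re_le_norm (1 - Complex.I * δ * z)
  simp at this
  have h2 : 0 ≤ δ * z.im := by positivity
  rw [abs_of_nonneg (by linarith)] at this
  linarith

/-- Neither part is known to lie in L₂, so Cauchy's theorem does not apply to them directly.
Dividing by 1 - iδz, which has no zero in the closed upper half-plane, produces the missing decay.
In the lower half-plane it vanishes at -i/δ, and the constant c = Gm(-i/δ), added to one part and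
subtracted from the other, removes that pole. The quotients A and (gm - c)/(1 - iδt) are then
orthogonal and add up to (gp + gm)/(1 - iδt), whose modulus is at most that of gp + gm. -/
theorem L2norm_weighted_le {gp gm : ℝ → ℂ} {Gp Gm : ℂ → ℂ} (hp : IsExtension upper gp 0 Gp)
    (hm : IsExtension lower gm 0 Gm) {δ : ℝ} (hδ : 0 < δ) :
    L2norm (fun t => (gp t + Gm (-(Complex.I / δ))) / (1 - Complex.I * δ * t))
      ≤ L2norm fun t => gp t + gm t := by
  have hδ' : (δ : ℂ) ≠ 0 := by exact_mod_cast hδ.ne'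
  set c := Gm (-(Complex.I / δ)) with hc
  set p : ℂ := Complex.I / δ with hp0
  have hIp : Complex.I * δ * p = -1 := by rw [hp0]; field_simp; simp
  have hne : ∀ z ∈ closure upper, 1 - Complex.I * δ * z ≠ 0 := fun z hz h => by
    have := norm_one_sub_I_mul_ge hδ (mem_closure_upper.1 hz)
    rw [h, norm_zero] at this
    linarith
  have hpu : p ∈ upper := by
    have : p = (1 / δ : ℝ) * Complex.I := by rw [hp0]; push_cast; ring
    rw [mem_upper, this]; simpa using hδ
  -- the reflected function
  set g : ℂ → ℂ := (starRingEnd ℂ) ∘ Gm ∘ (starRingEnd ℂ) with hg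
  have hgd : DifferentiableOn ℂ g upper := fun z hz => by
    have h1 : DifferentiableAt ℂ Gm ((starRingEnd ℂ) z) :=
      hm.analytic.differentiableAt ((isOpen_lt Complex.continuous_im continuous_const).mem_nhds
        (by simpa [mem_upper] using hz))
    simpa using h1.conj_conj.differentiableWithinAt
  have hgc : ContinuousOn g (closure upper) :=
    Complex.continuous_conj.comp_continuousOn (hm.continuous.comp
      Complex.continuous_conj.continuousOn fun z hz => by
        simpa [mem_closure_lower, mem_closure_upper] using hz)
  have hgp : g p = (starRingEnd ℂ) c := by
    simp only [hg, Function.comp, hc, hp0]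
    congr 2
    simp [neg_div]
  obtain ⟨Mp, hMp0, hMp⟩ := hp.exists_norm_le
  obtain ⟨Mm, hMm0, hMm⟩ := hm.exists_norm_le
  have hgM : ∀ z ∈ closure upper, ‖g z‖ ≤ Mm := fun z hz => by
    simp only [hg, Function.comp, RCLike.norm_conj]
    exact hMm _ (by simpa [mem_closure_lower, mem_closure_upper] using hz)
  have hun : upper ∈ 𝓝 p := isOpen_upper.mem_nhds hpu
  set A : ℂ → ℂ := fun z => (Gp z + c) / (1 - Complex.I * δ * z) with hA
  set B : ℂ → ℂ := fun z => dslope g p z / (Complex.I * δ) with hB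
  have hAd : DifferentiableOn ℂ A upper := (hp.analytic.add_const c).div (by fun_prop)
    fun z hz => hne z (subset_closure hz)
  have hAc : ContinuousOn A (closure upper) := (hp.continuous.add continuousOn_const).div
    (by fun_prop) hne
  have hBd : DifferentiableOn ℂ B upper :=
    ((Complex.differentiableOn_dslope hun).2 hgd).div_const _
  have hBc : ContinuousOn B (closure upper) :=
    ((continuousOn_dslope (mem_of_superset hun subset_closure)).2
      ⟨hgc, hgd.differentiableAt hun⟩).div_const _
  have hBeq : ∀ z, z ≠ p → B z = (g z - (starRingEnd ℂ) c) / (1 + Complex.I * δ * z) := by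
    intro z hz
    simp only [hB]
    rw [dslope_of_ne _ hz, slope_def_field, hgp, div_div]
    congr 1
    linear_combination -hIp
  obtain ⟨MA, hMA0, hMA⟩ := exists_decay_of_mul_sub isClosed_closure hAc (p := -p)
    (M := (Mp + ‖c‖) / δ) fun z hz => by
      have : A z * (z - -p) = (Gp z + c) / (-(Complex.I * δ)) := by
        simp only [hA]
        rw [div_mul_eq_mul_div, div_eq_div_iff (hne z hz) (by simp [hδ'])]
        linear_combination (-(Gp z + c)) * hIp
      rw [← norm_mul, this, norm_div, norm_neg, norm_mul, Complex.norm_I, one_mul,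
        Complex.norm_real, Real.norm_of_nonneg hδ.le]
      gcongr
      exact (norm_add_le _ _).trans (add_le_add_left (hMp z hz) _)
  obtain ⟨MB, hMB0, hMB⟩ := exists_decay_of_mul_sub isClosed_closure hBc (p := p)
    (M := (Mm + Mm) / δ) fun z hz => by
      by_cases hzp : z = p
      · rw [hzp, sub_self, norm_zero, mul_zero]; positivity
      have : B z * (z - p) = (g z - g p) / (Complex.I * δ) := by
        simp only [hB]
        rw [dslope_of_ne _ hzp, slope_def_field]
        have := sub_ne_zero.2 hzp
        field_simp
      rw [← norm_mul, this, norm_div, norm_mul, Complex.norm_I, one_mul,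
        Complex.norm_real, Real.norm_of_nonneg hδ.le]
      gcongr
      exact (norm_sub_le _ _).trans (add_le_add (hgM z hz) (hgM p (subset_closure hpu)))
  have hint : ∫ t : ℝ, A t * B t = 0 := by
    refine integral_ofReal_eq_zero (h := fun z => A z * B z) (hAd.mul hBd) (hAc.mul hBc)
      (M := MA * MB) fun z hz => ?_
    have h1 := mul_le_mul (hMA z hz) (hMB z hz) (by positivity) hMA0
    refine le_trans ?_ h1
    rw [norm_mul, show ‖A z‖ * (1 + ‖z‖) * (‖B z‖ * (1 + ‖z‖))
      = ‖A z‖ * ‖B z‖ * (1 + ‖z‖) ^ 2 by ring]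
    gcongr
    nlinarith [norm_nonneg z]
  have mA : MemLp (fun t : ℝ => A t) 2 volume := memLp_two_of_decay (continuous_comp_ofReal hAc)
    (M := MA) fun t => by simpa using hMA t (ofReal_mem_closure_upper t)
  have mB : MemLp (fun t : ℝ => B t) 2 volume := memLp_two_of_decay (continuous_comp_ofReal hBc)
    (M := MB) fun t => by simpa using hMB t (ofReal_mem_closure_upper t)
  have key := L2norm_le_of_integral_mul_eq_zero mA mB hint
  have e1 : (fun t : ℝ => (gp t + c) / (1 - Complex.I * δ * t)) = fun t : ℝ => A t := by
    funext t; simp only [hA, hp.boundary]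
  rw [e1]
  refine key.trans (eLpNorm_mono fun t => ?_)
  have htp : (t : ℂ) ≠ p := fun h => by
    have := mem_upper.1 hpu
    rw [← h] at this; simp at this
  have hn := hne t (ofReal_mem_closure_upper t)
  have e2 : A t + (starRingEnd ℂ) (B t) = (gp t + gm t) / (1 - Complex.I * δ * t) := by
    rw [hBeq _ htp]
    simp only [hA, hg, Function.comp, map_div₀, map_sub, map_add, map_mul, map_one,
      Complex.conj_conj, Complex.conj_ofReal, Complex.conj_I, hp.boundary, hm.boundary]
    rw [show (1 : ℂ) + -Complex.I * δ * t = 1 - Complex.I * δ * t by ring, ← add_div]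
    ring
  rw [e2, norm_div]
  exact div_le_self (norm_nonneg _)
    (norm_one_sub_I_mul_ge hδ (mem_closure_upper.1 (ofReal_mem_closure_upper t)))

/-- Let δ → 0 in `L2norm_weighted_le`. The point -i/δ goes to infinity, so the constant Gm(-i/δ)
tends to 0, the weighted functions converge pointwise to Fp, and Fatou's lemma gives the bound. No
integrability of F is needed, as the norms may be infinite. -/
theorem IsAdditiveSplitting.L2norm_plus_le {F Fp Fm : ℝ → ℂ} (h : IsAdditiveSplitting F Fp Fm) :
    L2norm Fp ≤ L2norm F := by
  obtain ⟨Gp, hp⟩ := h.plus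
  obtain ⟨Gm, hm⟩ := h.minus
  have hF : F = fun t => Fp t + Fm t := funext h.eq_add
  have hFp : Continuous Fp := (continuous_comp_ofReal hp.continuous).congr hp.boundary
  set δ : ℕ → ℝ := fun n => 1 / ((n : ℝ) + 1) with hδ
  have hδ0 : ∀ n, 0 < δ n := fun n => by positivity
  have hδl : Tendsto δ atTop (𝓝 0) := tendsto_one_div_add_atTop_nhds_zero_nat
  have hcl : Tendsto (fun n => Gm (-(Complex.I / δ n))) atTop (𝓝 0) := by
    refine hm.limit.comp (tendsto_inf.2 ⟨?_, tendsto_principal.2 (Eventually.of_forall ?_)⟩)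
    · refine tendsto_norm_atTop_iff_cobounded.1 ?_ |>.mono_right Metric.cobounded_eq_cocompact.le
      have : (fun n : ℕ => ‖-(Complex.I / (δ n : ℂ))‖) = fun n : ℕ => (n : ℝ) + 1 := by
        funext n
        rw [norm_neg, norm_div, Complex.norm_I, Complex.norm_real,
          Real.norm_of_nonneg (hδ0 n).le, hδ]
        simp
      rw [this]
      exact tendsto_atTop_add_const_right _ _ tendsto_natCast_atTop_atTop
    · intro n
      have : -(Complex.I / (δ n : ℂ)) = ((-(1 / δ n) : ℝ) : ℂ) * Complex.I := by push_cast; ring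
      rw [mem_closure_lower, this]
      simpa using (hδ0 n).le
  have key := Lp.eLpNorm_lim_le_liminf_eLpNorm (p := 2) (μ := volume)
    (f := fun (n : ℕ) (t : ℝ) => (Fp t + Gm (-(Complex.I / δ n))) / (1 - Complex.I * δ n * t))
    (fun n => (Continuous.div (by fun_prop) (by fun_prop) fun t ht => by
      have := norm_one_sub_I_mul_ge (hδ0 n) (mem_closure_upper.1 (ofReal_mem_closure_upper t))
      rw [ht, norm_zero] at this
      linarith).aestronglyMeasurable) Fp
    (Eventually.of_forall fun t => by
      have h1 : Tendsto (fun n => 1 - Complex.I * δ n * t) atTop (𝓝 (1 - Complex.I * (0 : ℝ) * t)) :=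
        ((tendsto_const_nhds.mul ((Complex.continuous_ofReal.tendsto _).comp hδl)).mul_const
          _).const_sub _
      have h2 := (hcl.const_add (Fp t)).div h1 (by simp)
      simp only [Complex.ofReal_zero, mul_zero, zero_mul, sub_zero, add_zero, div_one] at h2
      exact h2)
  refine key.trans ((liminf_le_liminf (v := fun _ => L2norm F) (Eventually.of_forall fun n => ?_)).trans
    (by simp))
  rw [hF]
  exact L2norm_weighted_le hp hm (hδ0 n)

theorem L2norm_comp_neg {g : ℝ → ℂ} (hg : Continuous g) :
    L2norm (fun t => g (-t)) = L2norm g :=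
  eLpNorm_comp_measurePreserving hg.aestronglyMeasurable (Measure.measurePreserving_neg volume)

theorem IsAdditiveSplitting.continuous_plus {F Fp Fm : ℝ → ℂ} (h : IsAdditiveSplitting F Fp Fm) :
    Continuous Fp := by
  obtain ⟨G, hG⟩ := h.plus
  exact (continuous_comp_ofReal hG.continuous).congr hG.boundary

theorem IsAdditiveSplitting.continuous_minus {F Fp Fm : ℝ → ℂ} (h : IsAdditiveSplitting F Fp Fm) :
    Continuous Fm := by
  simpa [Function.comp_def] using h.reflect.continuous_plus.comp continuous_neg

theorem IsAdditiveSplitting.continuous {F Fp Fm : ℝ → ℂ} (h : IsAdditiveSplitting F Fp Fm) :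
    Continuous F :=
  (h.continuous_plus.add h.continuous_minus).congr fun t => (h.eq_add t).symm

theorem IsExtension.tendsto {U : Set ℂ} {g : ℝ → ℂ} {w : ℂ} {G : ℂ → ℂ} (h : IsExtension U g w G)
    (hU : ∀ t : ℝ, (t : ℂ) ∈ closure U) : Tendsto g (cocompact ℝ) (𝓝 w) := by
  refine (h.limit.comp (tendsto_inf.2 ⟨Complex.isometry_ofReal.isClosedEmbedding.tendsto_cocompact,
    tendsto_principal.2 (Eventually.of_forall hU)⟩)).congr h.boundary

theorem IsAdditiveSplitting.tendsto_zero {F Fp Fm : ℝ → ℂ} (h : IsAdditiveSplitting F Fp Fm) :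
    Tendsto F (cocompact ℝ) (𝓝 0) := by
  obtain ⟨Gp, hp⟩ := h.plus
  obtain ⟨Gm, hm⟩ := h.minus
  have := (hp.tendsto ofReal_mem_closure_upper).add (hm.tendsto ofReal_mem_closure_lower)
  rw [add_zero] at this
  exact this.congr fun t => (h.eq_add t).symm

theorem IsAdditiveSplitting.L2norm_minus_le {F Fp Fm : ℝ → ℂ} (h : IsAdditiveSplitting F Fp Fm) :
    L2norm Fm ≤ L2norm F := by
  rw [← L2norm_comp_neg h.continuous, ← L2norm_comp_neg h.continuous_minus]
  exact h.reflect.L2norm_plus_le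

/-! ### Logarithms -/

theorem mem_slitPlane_of_norm_sub_one_le {w : ℂ} (hw : ‖w - 1‖ ≤ 1 / 2) :
    w ∈ Complex.slitPlane := by
  simpa using Complex.mem_slitPlane_of_norm_lt_one (hw.trans_lt (by norm_num))

theorem norm_log_le {w : ℂ} (hw : ‖w - 1‖ ≤ 1 / 2) : ‖Complex.log w‖ ≤ 3 / 2 * ‖w - 1‖ := by
  simpa using Complex.norm_log_one_add_half_le_self hw

/-! ### Operations on half-plane extensions -/

theorem IsExtension.add {U : Set ℂ} {g g' : ℝ → ℂ} {w w' : ℂ} {G G' : ℂ → ℂ}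
    (h : IsExtension U g w G) (h' : IsExtension U g' w' G') :
    IsExtension U (fun t => g t + g' t) (w + w') (fun z => G z + G' z) where
  analytic := h.analytic.add h'.analytic
  continuous := h.continuous.add h'.continuous
  limit := h.limit.add h'.limit
  boundary t := by rw [h.boundary, h'.boundary]

theorem IsExtension.div {U : Set ℂ} {g g' : ℝ → ℂ} {w w' : ℂ} {G G' : ℂ → ℂ}
    (h : IsExtension U g w G) (h' : IsExtension U g' w' G') (hw : w' ≠ 0)
    (h0 : ∀ z ∈ closure U, G' z ≠ 0) :
    IsExtension U (fun t => g t / g' t) (w / w') (fun z => G z / G' z) where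
  analytic := h.analytic.div h'.analytic fun z hz => h0 z (subset_closure hz)
  continuous := h.continuous.div h'.continuous h0
  limit := h.limit.div h'.limit hw
  boundary t := by rw [h.boundary, h'.boundary]

theorem IsExtension.log {U : Set ℂ} {g : ℝ → ℂ} {G : ℂ → ℂ} (h : IsExtension U g 1 G)
    (hG : ∀ z ∈ closure U, ‖G z - 1‖ ≤ 1 / 2) :
    IsExtension U (fun t => Complex.log (g t)) 0 (fun z => Complex.log (G z)) where
  analytic := h.analytic.clog fun z hz => mem_slitPlane_of_norm_sub_one_le (hG z (subset_closure hz))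
  continuous := h.continuous.clog fun z hz => mem_slitPlane_of_norm_sub_one_le (hG z hz)
  limit := by simpa using h.limit.clog (by simp)
  boundary t := by rw [h.boundary]

theorem IsExtension.exp {U : Set ℂ} {g : ℝ → ℂ} {G : ℂ → ℂ} (h : IsExtension U g 0 G) :
    IsExtension U (fun t => Complex.exp (g t)) 1 (fun z => Complex.exp (G z)) where
  analytic := h.analytic.cexp
  continuous := h.continuous.cexp
  limit := by simpa using h.limit.cexp
  boundary t := by rw [h.boundary]

/-! ### Logarithms on the half-plane by vertical shifts -/

theorem add_I_mem_upper {z : ℂ} {s : ℝ} (hs : 0 ≤ s) (hz : z ∈ upper) :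
    z + s * Complex.I ∈ upper := by
  have := mem_upper.1 hz
  rw [mem_upper]; simp; linarith

theorem add_I_mem_closure_upper {z : ℂ} {s : ℝ} (hs : 0 ≤ s) (hz : z ∈ closure upper) :
    z + s * Complex.I ∈ closure upper := by
  have := mem_closure_upper.1 hz
  rw [mem_closure_upper]; simp; linarith

theorem tendsto_add_const_cocompact (s : ℝ) (hs : 0 ≤ s) :
    Tendsto (fun z : ℂ => z + s * Complex.I) (cocompact ℂ ⊓ 𝓟 (closure upper))
      (cocompact ℂ ⊓ 𝓟 (closure upper)) := by
  refine tendsto_inf.2 ⟨((Homeomorph.addRight (s * Complex.I)).isClosedEmbedding.tendsto_cocompact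
    ).mono_left inf_le_left, tendsto_principal.2 ?_⟩
  filter_upwards [mem_inf_of_right (mem_principal_self _)] with z hz
  exact add_I_mem_closure_upper hs hz

theorem IsExtension.shift {g : ℝ → ℂ} {w : ℂ} {G : ℂ → ℂ} (h : IsExtension upper g w G) {s : ℝ}
    (hs : 0 ≤ s) :
    IsExtension upper (fun t => G (t + s * Complex.I)) w (fun z => G (z + s * Complex.I)) where
  analytic := h.analytic.comp (by fun_prop) fun _ hz => add_I_mem_upper hs hz
  continuous := h.continuous.comp (by fun_prop) fun _ hz => add_I_mem_closure_upper hs hz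
  limit := h.limit.comp (tendsto_add_const_cocompact s hs)
  boundary _ := rfl

/-- Telescoping: G(z) is the product of n quotients of the form G(w)/G(w + is) and of G(z + nis).
Every factor lies within 1/2 of 1, so the sum of principal logarithms is a logarithm of G that is
continuous up to the boundary and visibly tends to 0 at infinity. The induction replaces G by its
shift. -/
theorem IsExtension.exists_log_of_steps {s : ℝ} (hs : 0 ≤ s) (n : ℕ) :
    ∀ {g : ℝ → ℂ} {G : ℂ → ℂ}, IsExtension upper g 1 G → (∀ z ∈ closure upper, G z ≠ 0) →
      (∀ z ∈ closure upper, ‖G z / G (z + s * Complex.I) - 1‖ ≤ 1 / 2) →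
      (∀ z ∈ closure upper, ‖G (z + (n * s : ℝ) * Complex.I) - 1‖ ≤ 1 / 2) →
      ∃ l Λ, IsExtension upper l 0 Λ ∧ ∀ z ∈ closure upper, Complex.exp (Λ z) = G z := by
  induction n with
  | zero =>
    intro g G h h0 _ h2
    exact ⟨_, _, h.log fun z hz => by simpa using h2 z hz, fun z hz => Complex.exp_log (h0 z hz)⟩
  | succ n ih =>
    intro g G h h0 h1 h2
    obtain ⟨l, Λ, hΛ, he⟩ := ih (h.shift hs) (fun z hz => h0 _ (add_I_mem_closure_upper hs hz))
      (fun z hz => h1 _ (add_I_mem_closure_upper hs hz)) (fun z hz => by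
        have := h2 z hz
        rwa [show z + ((n + 1 : ℕ) * s : ℝ) * Complex.I
          = z + (n * s : ℝ) * Complex.I + s * Complex.I by push_cast; ring] at this)
    have hd := h.div (h.shift hs) one_ne_zero fun z hz => h0 _ (add_I_mem_closure_upper hs hz)
    rw [div_one] at hd
    refine ⟨_, _, by simpa using hΛ.add (hd.log h1), fun z hz => ?_⟩
    have hz' := h0 _ (add_I_mem_closure_upper hs hz)
    rw [Complex.exp_add, he z hz, Complex.exp_log (div_ne_zero (h0 z hz) hz')]
    field_simp

/-- A non-vanishing analytic function on the closed upper half-plane tending to `1` at infinity has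
a logarithm tending to `0`. -/
theorem IsExtension.exists_log {g : ℝ → ℂ} {G : ℂ → ℂ} (h : IsExtension upper g 1 G)
    (h0 : ∀ z ∈ closure upper, G z ≠ 0) :
    ∃ l Λ, IsExtension upper l 0 Λ ∧ ∀ t, Complex.exp (l t) = g t := by
  obtain ⟨M, hM0, hM⟩ := exists_norm_le_of_tendsto (G := fun z => (G z)⁻¹) (w := 1)
    isClosed_closure (h.continuous.inv₀ h0)
    (by simpa using h.limit.inv₀ one_ne_zero)
  have hunif : UniformContinuousOn G (closure upper) := by
    rw [uniformContinuousOn_iff_restrict]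
    refine (continuousOn_iff_continuous_domRestrict.1 h.continuous
      ).uniformContinuous_of_tendsto_cocompact (x := 1) (h.limit.comp (tendsto_inf.2
        ⟨isClosed_closure.isClosedEmbedding_subtypeVal.tendsto_cocompact, tendsto_principal.2
          (Eventually.of_forall fun z => z.2)⟩))
  -- M bounds 1/G, so a variation of G below 1/(2(M + 1)) keeps the quotients G(z)/G(z + iη/2)
  -- within 1/2 of 1.
  obtain ⟨η, hη, hηG⟩ := Metric.uniformContinuousOn_iff.1 hunif (1 / (2 * (M + 1))) (by positivity)
  have hfar : ∀ᶠ z in cocompact ℂ ⊓ 𝓟 (closure upper), ‖G z - 1‖ < 1 / 2 := by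
    have := (h.limit.sub_const 1).norm
    rw [sub_self, norm_zero] at this
    exact this.eventually (gt_mem_nhds (by norm_num))
  rw [eventually_inf_principal, ← Metric.cobounded_eq_cocompact,
    (Metric.hasBasis_cobounded_compl_closedBall (0 : ℂ)).eventually_iff] at hfar
  obtain ⟨S, -, hS⟩ := hfar
  -- After n shifts by η/2 the whole half-plane lies outside the ball of radius S, where |G - 1| <
  -- 1/2.
  obtain ⟨n, hn⟩ := exists_nat_gt (S / (η / 2))
  rw [div_lt_iff₀ (by positivity)] at hn
  obtain ⟨l, Λ, hΛ, he⟩ := h.exists_log_of_steps (s := η / 2) (by positivity) n h0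
    (fun z hz => by
      have hz' := add_I_mem_closure_upper (s := η / 2) (by positivity) hz
      have h1 := hηG z hz _ hz' (by
        rw [dist_comm, dist_eq_norm, add_sub_cancel_left, norm_mul, Complex.norm_I, mul_one,
          Complex.norm_real, Real.norm_of_nonneg (by positivity)]
        linarith)
      rw [dist_eq_norm] at h1
      rw [div_sub_one (h0 _ hz'), div_eq_mul_inv, norm_mul]
      calc _ ≤ 1 / (2 * (M + 1)) * M :=
            mul_le_mul h1.le (hM _ hz') (norm_nonneg _) (by positivity)
        _ ≤ 1 / 2 := by
            rw [div_mul_eq_mul_div, div_le_div_iff₀ (by positivity) (by positivity)]; linarith)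
    (fun z hz => by
      have hz' := add_I_mem_closure_upper (s := n * (η / 2)) (by positivity) hz
      refine (hS ?_ hz').le
      have h1 := Complex.abs_im_le_norm (z + (n * (η / 2) : ℝ) * Complex.I)
      have h2 := (le_abs_self _).trans h1
      have h3 := mem_closure_upper.1 hz
      simp only [Complex.add_im, Complex.mul_im, Complex.ofReal_re, Complex.I_im, mul_one,
        Complex.ofReal_im, Complex.I_re, mul_zero, add_zero] at h2
      simp only [Set.mem_compl_iff, Metric.mem_closedBall, dist_zero_right, not_le]
      linarith)
  exact ⟨l, Λ, hΛ, fun t => by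
    rw [← hΛ.boundary, he _ (ofReal_mem_closure_upper t), h.boundary]⟩

theorem IsWienerHopf.exists_log {F Fp Fm : ℝ → ℂ} (h : IsWienerHopf F Fp Fm) :
    ∃ lp lm : ℝ → ℂ, IsAdditiveSplitting (fun t => lp t + lm t) lp lm ∧
      (∀ t, Complex.exp (lp t) = Fp t) ∧ ∀ t, Complex.exp (lm t) = Fm t := by
  obtain ⟨Gp, hGp, hp0⟩ := h.plus
  obtain ⟨Gm, hGm, hm0⟩ := h.minus
  obtain ⟨lp, Λp, hp, hpe⟩ := hGp.exists_log hp0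
  obtain ⟨lm, Λm, hm, hme⟩ := hGm.reflect.exists_log fun z hz => hm0 _ (by
    simpa [mem_closure_lower, mem_closure_upper] using hz)
  exact ⟨lp, fun t => lm (-t), ⟨fun _ => rfl, ⟨_, hp⟩, ⟨_, hm.reflect'⟩⟩, hpe,
    fun t => by rw [hme, neg_neg]⟩

/-- If Im u reached ±π, exp u would be a negative real number, at distance more than 1 from 1. By
connectedness Im u thus stays in (-π, π), so u is the principal logarithm of exp u, and |log w| ≤
(3/2)|w - 1| applies. -/
theorem norm_le_of_norm_exp_sub_one_le {X : Type*} [TopologicalSpace X] {S : Set X}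
    (hS : IsPreconnected S) {u : X → ℂ}
    (hu : ContinuousOn u S) (h1 : ∀ t ∈ S, ‖Complex.exp (u t) - 1‖ ≤ 1 / 2)
    {t₀ : X} (ht₀ : t₀ ∈ S) (h0 : |(u t₀).im| < Real.pi) :
    ∀ t ∈ S, ‖u t‖ ≤ 3 / 2 * ‖Complex.exp (u t) - 1‖ := by
  intro t ht
  have him : |(u t).im| < Real.pi := by
    by_contra! hcon
    obtain ⟨s, hs, hsu⟩ := hS.intermediate_value ht₀ ht
      (f := fun t => |(u t).im|) (by fun_prop) ⟨h0.le, hcon⟩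
    have h2 := Complex.abs_re_le_norm (Complex.exp (u s) - 1)
    have h3 : Real.cos (u s).im = -1 := by
      rw [← Real.cos_abs, show |(u s).im| = Real.pi from hsu, Real.cos_pi]
    rw [Complex.sub_re, Complex.exp_re, h3, Complex.one_re] at h2
    have h4 := (neg_le_abs _).trans (h2.trans (h1 s hs))
    have := Real.exp_pos (u s).re
    linarith
  have := norm_log_le (h1 t ht)
  rwa [Complex.log_exp (neg_lt_of_abs_lt him) (lt_of_abs_lt him).le] at this

theorem norm_le_of_norm_exp_sub_one_le_of_tendsto {u : ℝ → ℂ} (hu : Continuous u)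
    (hl : Tendsto u atTop (𝓝 0)) (h1 : ∀ t, ‖Complex.exp (u t) - 1‖ ≤ 1 / 2) (t : ℝ) :
    ‖u t‖ ≤ 3 / 2 * ‖Complex.exp (u t) - 1‖ := by
  have : ∀ᶠ t in atTop, |(u t).im| < Real.pi := by
    have h := ((Complex.continuous_im.tendsto _).comp hl).abs
    simp only [Complex.zero_im, abs_zero] at h
    exact h.eventually (gt_mem_nhds Real.pi_pos)
  obtain ⟨t₀, ht₀⟩ := this.exists
  exact norm_le_of_norm_exp_sub_one_le isPreconnected_univ hu.continuousOn (fun t _ => h1 t)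
    (Set.mem_univ t₀) ht₀ t (Set.mem_univ t)

/-! ### Difference bounds for entire functions -/

theorem norm_sub_le_of_deriv_le {φ ψ : ℂ → ℂ} (hφ : ∀ z, HasDerivAt φ (ψ z) z) {B : ℝ} {a b : ℂ}
    (hB : ∀ z ∈ segment ℝ a b, ‖ψ z‖ ≤ B) : ‖φ a - φ b‖ ≤ B * ‖a - b‖ :=
  (convex_segment a b).norm_image_sub_le_of_norm_hasDerivWithin_le
    (fun z _ => (hφ z).hasDerivWithinAt) hB (right_mem_segment ℝ a b) (left_mem_segment ℝ a b)

/-- Convexity of the real exponential carries the bound R on |exp| from the endpoints to the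
segment, and the mean value inequality applies with the same R. -/
theorem norm_exp_sub_exp_le {a b : ℂ} {R : ℝ} (ha : ‖Complex.exp a‖ ≤ R)
    (hb : ‖Complex.exp b‖ ≤ R) : ‖Complex.exp a - Complex.exp b‖ ≤ R * ‖a - b‖ := by
  refine norm_sub_le_of_deriv_le Complex.hasDerivAt_exp fun z hz => ?_
  rw [Complex.norm_exp] at *
  obtain ⟨s, t, hs, ht, hst, rfl⟩ := hz
  have h1 := convexOn_exp.2 (Set.mem_univ a.re) (Set.mem_univ b.re) hs ht hst
  simp only [smul_eq_mul] at h1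
  have h2 : s * Real.exp a.re + t * Real.exp b.re ≤ s * R + t * R := by gcongr
  rw [← add_mul, hst, one_mul] at h2
  simpa using h1.trans h2

theorem norm_cosh_le (z : ℂ) : ‖Complex.cosh z‖ ≤ Real.cosh z.re := by
  rw [Complex.cosh, norm_div, Real.cosh_eq, Complex.norm_ofNat]
  gcongr
  refine (norm_add_le _ _).trans ?_
  rw [Complex.norm_exp, Complex.norm_exp, Complex.neg_re]

theorem norm_sinh_le (z : ℂ) : ‖Complex.sinh z‖ ≤ Real.cosh z.re := by
  rw [Complex.sinh, norm_div, Real.cosh_eq, Complex.norm_ofNat]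
  gcongr
  refine (norm_sub_le _ _).trans ?_
  rw [Complex.norm_exp, Complex.norm_exp, Complex.neg_re]

theorem cosh_re_le_of_mem_segment {a b z : ℂ} {E : ℝ} (ha : Real.cosh a.re ≤ E)
    (hb : Real.cosh b.re ≤ E) (hz : z ∈ segment ℝ a b) : Real.cosh z.re ≤ E := by
  obtain ⟨s, t, hs, ht, hst, rfl⟩ := hz
  have e1 := convexOn_exp.2 (Set.mem_univ a.re) (Set.mem_univ b.re) hs ht hst
  have e2 := convexOn_exp.2 (Set.mem_univ (-a.re)) (Set.mem_univ (-b.re)) hs ht hst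
  simp only [smul_eq_mul] at e1 e2
  have h2 : s * Real.cosh a.re + t * Real.cosh b.re ≤ s * E + t * E := by gcongr
  rw [← add_mul, hst, one_mul] at h2
  refine le_trans ?_ h2
  rw [Real.cosh_eq, Real.cosh_eq, Real.cosh_eq]
  have e3 : (s • a + t • b).re = s * a.re + t * b.re := by simp
  rw [e3, show -(s * a.re + t * b.re) = s * -a.re + t * -b.re by ring]
  linarith

theorem norm_cosh_sub_cosh_le {a b : ℂ} {E : ℝ} (ha : Real.cosh a.re ≤ E)
    (hb : Real.cosh b.re ≤ E) : ‖Complex.cosh a - Complex.cosh b‖ ≤ E * ‖a - b‖ :=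
  norm_sub_le_of_deriv_le Complex.hasDerivAt_cosh fun _ hz =>
    (norm_sinh_le _).trans (cosh_re_le_of_mem_segment ha hb hz)

theorem norm_sinh_sub_sinh_le {a b : ℂ} {E : ℝ} (ha : Real.cosh a.re ≤ E)
    (hb : Real.cosh b.re ≤ E) : ‖Complex.sinh a - Complex.sinh b‖ ≤ E * ‖a - b‖ :=
  norm_sub_le_of_deriv_le Complex.hasDerivAt_sinh fun _ hz =>
    (norm_cosh_le _).trans (cosh_re_le_of_mem_segment ha hb hz)

/-! ### Norm estimates -/

theorem L2norm_le_of_norm_le_mul {u v : ℝ → ℂ} {c ε : ℝ} (hc : 0 ≤ c)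
    (h : ∀ t, ‖u t‖ ≤ c * ‖v t‖) (hv : L2norm v ≤ ENNReal.ofReal ε) :
    L2norm u ≤ ENNReal.ofReal (c * ε) := by
  rw [ENNReal.ofReal_mul hc]
  exact (eLpNorm_le_mul_eLpNorm_of_ae_le_mul (Eventually.of_forall h) 2).trans (by gcongr; exact hv)

/-- Functions of bounded Hölder constant that are close in `L₂` are uniformly close. -/
theorem exists_norm_sub_le_of_L2norm_lt (C : ℂ) (H : ℝ≥0) {α : ℝ≥0} (hα : 0 < α) {δ : ℝ}
    (hδ : 0 < δ) : ∃ ε₀ : ℝ, 0 < ε₀ ∧ ∀ f f' : ℝ → ℂ, HolderWith H α f → HolderWith H α f' →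
      L2norm (fun t => C * f t - C * f' t) < ENNReal.ofReal ε₀ →
      ∀ t, ‖C * f t - C * f' t‖ ≤ δ := by
  have hlim : Tendsto (fun η : ℝ => 2 * ‖C‖ * H * η ^ (α : ℝ)) (𝓝[>] 0) (𝓝 0) := by
    have h1 : ContinuousAt (fun η : ℝ => 2 * ‖C‖ * H * η ^ (α : ℝ)) 0 :=
      continuousAt_const.mul (Real.continuousAt_rpow_const _ _ (Or.inr (by positivity)))
    have h2 := h1.tendsto.mono_left (nhdsWithin_le_nhds (s := Set.Ioi 0))
    rwa [Real.zero_rpow (by positivity), mul_zero] at h2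
  obtain ⟨η, hη, hη0⟩ := ((hlim.eventually (gt_mem_nhds (half_pos hδ))).and
    self_mem_nhdsWithin).exists
  -- η is chosen so that Cf - Cf' varies by less than δ/2 over an interval of length η. If the
  -- difference exceeds δ at t, it is at least δ/2 on [t, t + η], so its L₂ norm is at least
  -- (δ/2)η^(1/2).
  refine ⟨δ / 2 * η ^ (1 / 2 : ℝ), by positivity, fun f f' hf hf' h t => ?_⟩
  by_contra! hcon
  refine absurd h (not_lt.2 ?_)
  have hind := eLpNorm_indicator_const (μ := volume) (p := 2) (c := (δ / 2 : ℝ))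
    (measurableSet_Icc (a := t) (b := t + η)) two_ne_zero ENNReal.ofNat_ne_top
  rw [Real.volume_Icc, add_sub_cancel_left, Real.enorm_of_nonneg (by positivity),
    ENNReal.toReal_ofNat, ENNReal.ofReal_rpow_of_pos hη0, ← ENNReal.ofReal_mul (by positivity)] at hind
  rw [← hind]
  refine eLpNorm_mono fun s => ?_
  by_cases hs : s ∈ Set.Icc t (t + η)
  · rw [Set.indicator_of_mem hs, Real.norm_of_nonneg (by positivity)]
    have hd : dist s t ≤ η := by
      rw [Real.dist_eq, abs_of_nonneg (by linarith [hs.1])]; linarith [hs.2]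
    have h1 := hf.dist_le s t
    have h2 := hf'.dist_le s t
    rw [dist_eq_norm] at h1 h2
    have h3 : (dist s t) ^ (α : ℝ) ≤ η ^ (α : ℝ) := by gcongr
    have h4 : ‖f s - f t‖ ≤ H * η ^ (α : ℝ) := h1.trans (by gcongr)
    have h5 : ‖f' s - f' t‖ ≤ H * η ^ (α : ℝ) := h2.trans (by gcongr)
    have h6 : C * f t - C * f' t
        = (C * f s - C * f' s) - (C * (f s - f t) - C * (f' s - f' t)) := by ring
    have h7 : ‖C * (f s - f t) - C * (f' s - f' t)‖ ≤ ‖C‖ * (H * η ^ (α : ℝ)) +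
        ‖C‖ * (H * η ^ (α : ℝ)) := by
      refine (norm_sub_le _ _).trans ?_
      rw [norm_mul, norm_mul]
      gcongr
    have h8 := norm_sub_le (C * f s - C * f' s) (C * (f s - f t) - C * (f' s - f' t))
    rw [← h6] at h8
    linarith
  · rw [Set.indicator_of_notMem hs, norm_zero]; positivity

/-! ### Algebra of the factors -/

/-- The square of the left side is 1, because cosh²(Cθ) = 1/(1 - C²f²). By continuity the product is
constantly 1 or constantly -1, and the normalisation of both branches at +∞ excludes -1. -/
theorem ScalarFactors.r_mul_cosh {C : ℂ} {f : ℝ → ℂ} (F : ScalarFactors C f)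
    (h1 : ∀ t, 1 + C * f t ≠ 0) (h2 : ∀ t, 1 - C * f t ≠ 0) (t : ℝ) :
    F.r t * Complex.cosh (C * F.θ t) = 1 := by
  have hcont : Continuous fun t => F.r t * Complex.cosh (C * F.θ t) :=
    F.r_continuous.mul (Complex.continuous_cosh.comp (F.θ_continuous.const_mul C))
  have hlim : Tendsto (fun t => F.r t * Complex.cosh (C * F.θ t)) atTop (𝓝 1) := by
    have := F.r_limit.mul ((Complex.continuous_cosh.tendsto _).comp (F.θ_limit.const_mul C))
    simpa using this
  have hsq : ∀ t, (F.r t * Complex.cosh (C * F.θ t)) ^ 2 = 1 := fun t => by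
    have e : Complex.exp (C * F.θ t) ^ 2 = (1 + C * f t) / (1 - C * f t) := by
      rw [← F.exp_θ, ← Complex.exp_nat_mul]; congr 1; push_cast; ring
    have e' : Complex.exp (-(C * F.θ t)) ^ 2 = (1 - C * f t) / (1 + C * f t) := by
      rw [Complex.exp_neg, inv_pow, e, inv_div]
    have e'' : Complex.exp (C * F.θ t) * Complex.exp (-(C * F.θ t)) = 1 := by
      rw [← Complex.exp_add, add_neg_cancel, Complex.exp_zero]
    have := h1 t
    have := h2 t
    rw [mul_pow, F.r_sq, Complex.cosh, div_pow, add_sq, e, e', mul_assoc, e'']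
    field_simp
    ring
  rcases isPreconnected_univ.eq_or_eq_neg_of_sq_eq (f := fun t => F.r t * Complex.cosh (C * F.θ t))
    (g := fun _ => (1 : ℂ)) hcont.continuousOn continuousOn_const
    (fun t _ => by simpa using hsq t) (fun _ => one_ne_zero) with h | h
  · exact h (Set.mem_univ t)
  · exfalso
    have h3 : Tendsto (fun t => F.r t * Complex.cosh (C * F.θ t)) atTop (𝓝 (-1)) :=
      tendsto_const_nhds.congr fun t => (h (Set.mem_univ t)).symm
    have h4 := tendsto_nhds_unique hlim h3
    norm_num at h4

/-- tanh(Cθ) = Cf follows from e^(2Cθ) = (1 + Cf)/(1 - Cf), so no further sign has to be fixed. -/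
theorem ScalarFactors.r_mul_sinh {C : ℂ} {f : ℝ → ℂ} (F : ScalarFactors C f)
    (h1 : ∀ t, 1 + C * f t ≠ 0) (h2 : ∀ t, 1 - C * f t ≠ 0) (t : ℝ) :
    F.r t * Complex.sinh (C * F.θ t) = C * f t := by
  have hc := F.r_mul_cosh h1 h2 t
  have e : Complex.exp (C * F.θ t) ^ 2 = (1 + C * f t) / (1 - C * f t) := by
    rw [← F.exp_θ, ← Complex.exp_nat_mul]; congr 1; push_cast; ring
  rw [eq_div_iff (h2 t)] at e
  have e'' : Complex.exp (C * F.θ t) * Complex.exp (-(C * F.θ t)) = 1 := by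
    rw [← Complex.exp_add, add_neg_cancel, Complex.exp_zero]
  have hE := Complex.exp_ne_zero (C * F.θ t)
  rw [Complex.cosh] at hc
  rw [Complex.sinh]
  refine mul_left_cancel₀ hE ?_
  linear_combination (-F.r t / 2) * e'' + (F.r t / 2) * e
    + C * f t * Complex.exp (C * F.θ t) * hc - C * f t * F.r t / 2 * e''

theorem offDiag_mul_self {k₁ k₂ C : ℂ} (hJ : C ^ 2 = k₁ * k₂) :
    offDiag k₁ k₂ * offDiag k₁ k₂ = C ^ 2 • (1 : Matrix (Fin 2) (Fin 2) ℂ) := by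
  rw [hJ, offDiag, Matrix.mul_fin_two]
  ext i j
  fin_cases i <;> fin_cases j <;> simp [mul_comm]

/-- Both factors are polynomials in J and J² = C² I, so the coefficients of I and J in the product
are r cosh(Cθ) and C⁻¹ r sinh(Cθ) by the addition theorems. -/
theorem ScalarFactors.dkMatrix_eq {k₁ k₂ C : ℂ} (hC : C ≠ 0) (hJ : C ^ 2 = k₁ * k₂)
    {f : ℝ → ℂ} (F : ScalarFactors C f) (h1 : ∀ t, 1 + C * f t ≠ 0) (h2 : ∀ t, 1 - C * f t ≠ 0)
    (t : ℝ) : dkMatrix (offDiag k₁ k₂) f t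
      = F.Kp (offDiag k₁ k₂) t * F.Km (offDiag k₁ k₂) t := by
  have hc := F.r_mul_cosh h1 h2 t
  have hs := F.r_mul_sinh h1 h2 t
  rw [F.θ_parts.eq_add, mul_add, F.r_factors.eq_mul] at hc hs
  rw [Complex.cosh_add] at hc
  rw [Complex.sinh_add] at hs
  simp only [Kp, Km, dkMatrix, dkFactor, smul_mul_smul_comm, add_mul, mul_add, smul_add,
    one_mul, mul_one, offDiag_mul_self hJ, smul_smul]
  rw [show ∀ a b c e : ℂ, a • (1 : Matrix (Fin 2) (Fin 2) ℂ) + b • offDiag k₁ k₂ +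
    (c • offDiag k₁ k₂ + e • 1) = (a + e) • 1 + (b + c) • offDiag k₁ k₂ from
    fun a b c e => by module]
  congr 1
  · rw [eq_comm]
    convert one_smul ℂ _ using 2
    refine Eq.trans ?_ hc
    field_simp
  · congr 1
    refine mul_left_cancel₀ hC ?_
    rw [← hs]
    field_simp

/-! ### Perturbation of the scalar factors -/

/-- exp(2C(θ - θ')) - 1 = 2(Cf - Cf')/((1 - Cf)(1 + Cf')), and |1 - Cf| ≥ dL. The smallness
assumption makes this at most 1/2, so the exponent is controlled by the exponential. -/
theorem ScalarFactors.norm_θ_sub_le {C : ℂ} (hC : C ≠ 0) {f f' : ℝ → ℂ} (F : ScalarFactors C f)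
    (F' : ScalarFactors C f') {d L : ℝ} (hd : 0 < d) (hL : 0 < L)
    (hfd : ∀ t, d ≤ ‖1 + C * f t‖ ∧ d ≤ ‖1 + C * f' t‖)
    (hfL : ∀ t, L ≤ ‖(1 - C * f t) / (1 + C * f t)‖)
    (hs : ∀ t, ‖C * f t - C * f' t‖ ≤ d ^ 2 * L / 4) (t : ℝ) :
    ‖F.θ t - F'.θ t‖ ≤ 2 / (‖C‖ * d ^ 2 * L) * ‖C * f t - C * f' t‖ := by
  have hC' := norm_pos_iff.2 hC
  have hexp : ∀ t, ‖Complex.exp (2 * C * (F.θ t - F'.θ t)) - 1‖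
      ≤ 2 / (d ^ 2 * L) * ‖C * f t - C * f' t‖ := fun t => by
    have n1 : 1 + C * f t ≠ 0 := norm_pos_iff.1 (hd.trans_le (hfd t).1)
    have n2 : 1 + C * f' t ≠ 0 := norm_pos_iff.1 (hd.trans_le (hfd t).2)
    have n3 : 1 - C * f t ≠ 0 := fun h => by
      have := hfL t
      rw [h, zero_div, norm_zero] at this
      linarith
    have n4 : 1 - C * f' t ≠ 0 := fun h => by
      -- Since `x / 0 = 0`, a zero of 1 - Cf' would make an exponential vanish; no lower bound on
      -- the second quotient is required.
      have := F'.exp_θ t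
      rw [h, div_zero] at this
      exact Complex.exp_ne_zero _ this
    have e : Complex.exp (2 * C * (F.θ t - F'.θ t)) - 1
        = 2 * (C * f t - C * f' t) / ((1 + C * f t) * (1 + C * f' t) *
          ((1 - C * f t) / (1 + C * f t))) := by
      rw [mul_sub, Complex.exp_sub, F.exp_θ, F'.exp_θ]
      field_simp
      ring
    rw [e, norm_div, norm_mul, norm_mul, norm_mul, Complex.norm_ofNat, div_mul_eq_mul_div]
    gcongr
    rw [sq]
    have := hfd t
    gcongr
    exacts [this.1, this.2, hfL t]
  have hsm : ∀ t, ‖Complex.exp (2 * C * (F.θ t - F'.θ t)) - 1‖ ≤ 1 / 2 := fun t => by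
    refine (hexp t).trans ((mul_le_mul_of_nonneg_left (hs t) (by positivity)).trans (le_of_eq ?_))
    field_simp; norm_num
  have key := norm_le_of_norm_exp_sub_one_le_of_tendsto
    (u := fun t => 2 * C * (F.θ t - F'.θ t)) ((F.θ_continuous.sub F'.θ_continuous).const_mul (2 * C))
    (by simpa using (F.θ_limit.sub F'.θ_limit).const_mul (2 * C)) hsm t
  rw [norm_mul, norm_mul, Complex.norm_ofNat] at key
  have h1 := key.trans (mul_le_mul_of_nonneg_left (hexp t) (by norm_num))
  have h2 : ‖F.θ t - F'.θ t‖ ≤ 3 / 2 * (2 / (d ^ 2 * L) * ‖C * f t - C * f' t‖) / (2 * ‖C‖) := by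
    rw [le_div_iff₀ (by positivity)]; linarith
  refine h2.trans ?_
  have : 0 ≤ 2 / (‖C‖ * d ^ 2 * L) * ‖C * f t - C * f' t‖ := by positivity
  generalize ‖C * f t - C * f' t‖ = y at *
  -- The argument gives 3/4 of the stated constant.
  rw [show 3 / 2 * (2 / (d ^ 2 * L) * y) / (2 * ‖C‖)
    = 3 / 4 * (2 / (‖C‖ * d ^ 2 * L) * y) by field_simp; ring]
  linarith

/-- With logarithms l = lp + lm of r and l' of r', the function exp(2(l - l')) = r²/r'² depends only
on f and f', and differs from 1 by at most (2N/m²)|Cf - Cf'|. Hence |l - l'| is bounded by a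
multiple of |Cf - Cf'|; projecting bounds lp - lp' and lm - lm' in L₂, and exponentiating costs the
factor R. -/
theorem ScalarFactors.L2norm_r_sub_le {C : ℂ} {f f' : ℝ → ℂ} (F : ScalarFactors C f)
    (F' : ScalarFactors C f') {m N ε R : ℝ} (hm : 0 < m)
    (hN : ∀ t, ‖C * f t‖ ≤ N ∧ ‖C * f' t‖ ≤ N) (hr : ∀ t, m ≤ ‖F'.r t‖)
    (hs : ∀ t, ‖C * f t - C * f' t‖ ≤ m ^ 2 / (4 * (|N| + 1)))
    (hε : L2norm (fun t => C * f t - C * f' t) ≤ ENNReal.ofReal ε)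
    (hR : F.BoundR R) (hR' : F'.BoundR R) :
    L2norm (fun t => F.rp t - F'.rp t) ≤ ENNReal.ofReal (5 * R * N / m ^ 2 * ε) ∧
      L2norm (fun t => F.rm t - F'.rm t) ≤ ENNReal.ofReal (5 * R * N / m ^ 2 * ε) := by
  have hN0 : 0 ≤ N := (norm_nonneg _).trans (hN 0).1
  have hR0 : 0 ≤ R := (norm_nonneg _).trans (hR 0).1
  rw [abs_of_nonneg hN0] at hs
  obtain ⟨lp, lm, hl, hlp, hlm⟩ := F.r_factors.exists_log
  obtain ⟨lp', lm', hl', hlp', hlm'⟩ := F'.r_factors.exists_log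
  have hsub := hl.sub hl'
  have hexp : ∀ t, ‖Complex.exp (2 * (lp t + lm t - (lp' t + lm' t))) - 1‖
      ≤ 2 * N / m ^ 2 * ‖C * f t - C * f' t‖ := fun t => by
    have n1 : F'.r t ≠ 0 := norm_pos_iff.1 (hm.trans_le (hr t))
    have e : Complex.exp (2 * (lp t + lm t - (lp' t + lm' t))) - 1
        = (C * f' t + C * f t) * (C * f' t - C * f t) / F'.r t ^ 2 := by
      rw [mul_sub, Complex.exp_sub, two_mul, two_mul, Complex.exp_add (lp t + lm t),
        Complex.exp_add (lp' t + lm' t), Complex.exp_add, Complex.exp_add, hlp, hlm, hlp', hlm',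
        ← F.r_factors.eq_mul, ← F'.r_factors.eq_mul, ← sq, ← sq, F.r_sq,
        div_sub_one (pow_ne_zero 2 n1)]
      congr 1
      rw [F'.r_sq]
      ring
    rw [e, norm_div, norm_mul, norm_pow, div_mul_eq_mul_div, norm_sub_rev (C * f' t)]
    gcongr
    · exact (norm_add_le _ _).trans (by linarith [(hN t).1, (hN t).2])
    · exact hr t
  have hsm : ∀ t, ‖Complex.exp (2 * (lp t + lm t - (lp' t + lm' t))) - 1‖ ≤ 1 / 2 := fun t => by
    refine (hexp t).trans ((mul_le_mul_of_nonneg_left (hs t) (by positivity)).trans ?_)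
    rw [div_mul_div_comm, div_le_div_iff₀ (by positivity) (by positivity)]
    nlinarith [sq_nonneg m]
  have hlim : Tendsto (fun t => 2 * (lp t + lm t - (lp' t + lm' t))) atTop (𝓝 0) := by
    have := (hsub.tendsto_zero.mono_left atTop_le_cocompact).const_mul 2
    simpa using this
  have hu : ∀ t, ‖lp t + lm t - (lp' t + lm' t)‖ ≤ 5 * N / m ^ 2 * ‖C * f t - C * f' t‖ :=
    fun t => by
    have key := norm_le_of_norm_exp_sub_one_le_of_tendsto (hsub.continuous.const_mul 2) hlim hsm t
    rw [norm_mul, Complex.norm_ofNat] at key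
    have h1 := key.trans (mul_le_mul_of_nonneg_left (hexp t) (by norm_num))
    have h2 : 0 ≤ N / m ^ 2 * ‖C * f t - C * f' t‖ := by positivity
    -- The argument gives 3/2 where the statement has 5.
    rw [mul_div_assoc] at h1 ⊢
    linarith
  have hL2 := L2norm_le_of_norm_le_mul (by positivity) hu hε
  have hp := L2norm_le_of_norm_le_mul hR0 (fun t => norm_exp_sub_exp_le (R := R)
    (by rw [hlp]; exact (hR t).1) (by rw [hlp']; exact (hR' t).1))
    (hsub.L2norm_plus_le.trans hL2)
  have hm' := L2norm_le_of_norm_le_mul hR0 (fun t => norm_exp_sub_exp_le (R := R)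
    (by rw [hlm]; exact (hR t).2) (by rw [hlm']; exact (hR' t).2))
    (hsub.L2norm_minus_le.trans hL2)
  have e : R * (5 * N / m ^ 2 * ε) = 5 * R * N / m ^ 2 * ε := by ring
  rw [e] at hp hm'
  simp only [hlp, hlp', hlm, hlm'] at hp hm'
  exact ⟨hp, hm'⟩

/-- For φ = cosh or sinh, ρφ(Cϑ) - ρ'φ(Cϑ') = ρ(φ(Cϑ) - φ(Cϑ')) + (ρ - ρ')φ(Cϑ') has norm at most s
= E(R|C|c₁ + c₂). The four matrix entries carry the weights 1, |k₁|/|C|, |k₂|/|C|, 1, and the sum of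
their squares is the number under the root. -/
theorem matL2norm_dkFactor_sub_le {k₁ k₂ C : ℂ} (hC : C ≠ 0) {ρ ρ' ϑ ϑ' : ℝ → ℂ}
    (hρ : Continuous ρ) (hρ' : Continuous ρ') (hϑ : Continuous ϑ) (hϑ' : Continuous ϑ')
    {R E c₁ c₂ : ℝ} (hc₁ : 0 ≤ c₁) (hc₂ : 0 ≤ c₂) (hR : ∀ t, ‖ρ t‖ ≤ R)
    (hE : ∀ t, Real.cosh (C * ϑ t).re ≤ E) (hE' : ∀ t, Real.cosh (C * ϑ' t).re ≤ E)
    (h₁ : L2norm (fun t => ϑ t - ϑ' t) ≤ ENNReal.ofReal c₁)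
    (h₂ : L2norm (fun t => ρ t - ρ' t) ≤ ENNReal.ofReal c₂) :
    matL2norm (fun t => dkFactor C (offDiag k₁ k₂) ρ ϑ t - dkFactor C (offDiag k₁ k₂) ρ' ϑ' t)
      ≤ ENNReal.ofReal (Real.sqrt (2 + (‖k₁‖ ^ 2 + ‖k₂‖ ^ 2) / ‖C‖ ^ 2) *
          (E * (R * ‖C‖ * c₁ + c₂))) := by
  have hC' := norm_pos_iff.2 hC
  have hR0 : 0 ≤ R := (norm_nonneg _).trans (hR 0)
  have hE0 : 0 ≤ E := (Real.cosh_pos _).le.trans (hE 0)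
  have aux : ∀ φ : ℂ → ℂ, Continuous φ → (∀ z, ‖φ z‖ ≤ Real.cosh z.re) →
      (∀ a b : ℂ, Real.cosh a.re ≤ E → Real.cosh b.re ≤ E → ‖φ a - φ b‖ ≤ E * ‖a - b‖) →
      L2norm (fun t => ρ t * φ (C * ϑ t) - ρ' t * φ (C * ϑ' t))
        ≤ ENNReal.ofReal (E * (R * ‖C‖ * c₁ + c₂)) := by
    intro φ hφ hφ1 hφ2
    have i1 : L2norm (fun t => ρ t * (φ (C * ϑ t) - φ (C * ϑ' t)))
        ≤ ENNReal.ofReal (R * (E * ‖C‖) * c₁) :=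
      L2norm_le_of_norm_le_mul (by positivity) (fun t => by
        rw [norm_mul, mul_assoc R]
        refine mul_le_mul (hR t) ?_ (norm_nonneg _) hR0
        refine (hφ2 _ _ (hE t) (hE' t)).trans (le_of_eq ?_)
        rw [← mul_sub, norm_mul, mul_assoc]) h₁
    have i2 : L2norm (fun t => (ρ t - ρ' t) * φ (C * ϑ' t)) ≤ ENNReal.ofReal (E * c₂) :=
      L2norm_le_of_norm_le_mul hE0 (fun t => by
        rw [norm_mul, mul_comm]
        exact mul_le_mul_of_nonneg_right ((hφ1 _).trans (hE' t)) (norm_nonneg _)) h₂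
    have e : (fun t => ρ t * φ (C * ϑ t) - ρ' t * φ (C * ϑ' t))
        = (fun t => ρ t * (φ (C * ϑ t) - φ (C * ϑ' t))) + fun t => (ρ t - ρ' t) * φ (C * ϑ' t) := by
      funext t; simp only [Pi.add_apply]; ring
    rw [e]
    refine (eLpNorm_add_le (Continuous.aestronglyMeasurable (by fun_prop))
      (Continuous.aestronglyMeasurable (by fun_prop)) one_le_two).trans
      ((add_le_add i1 i2).trans ?_)
    rw [← ENNReal.ofReal_add (by positivity) (by positivity)]
    exact ENNReal.ofReal_le_ofReal (le_of_eq (by ring))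
  have b1 := aux _ Complex.continuous_cosh norm_cosh_le fun _ _ => norm_cosh_sub_cosh_le
  have b2 := aux _ Complex.continuous_sinh norm_sinh_le fun _ _ => norm_sinh_sub_sinh_le
  set s := E * (R * ‖C‖ * c₁ + c₂) with hs
  have hs0 : 0 ≤ s := by positivity
  have b3 : ∀ k : ℂ, L2norm (fun t => k * (1 / C * (ρ t * Complex.sinh (C * ϑ t)
      - ρ' t * Complex.sinh (C * ϑ' t)))) ≤ ENNReal.ofReal (‖k‖ / ‖C‖ * s) := fun k =>
    L2norm_le_of_norm_le_mul (by positivity) (fun t => le_of_eq (by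
      rw [norm_mul, norm_mul, norm_div, norm_one, ← mul_assoc, mul_one_div])) b2
  have e00 : (fun t => (dkFactor C (offDiag k₁ k₂) ρ ϑ t
      - dkFactor C (offDiag k₁ k₂) ρ' ϑ' t) 0 0)
      = fun t => ρ t * Complex.cosh (C * ϑ t) - ρ' t * Complex.cosh (C * ϑ' t) := by
    funext t; simp [dkFactor, offDiag]
  have e11 : (fun t => (dkFactor C (offDiag k₁ k₂) ρ ϑ t
      - dkFactor C (offDiag k₁ k₂) ρ' ϑ' t) 1 1)
      = fun t => ρ t * Complex.cosh (C * ϑ t) - ρ' t * Complex.cosh (C * ϑ' t) := by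
    funext t; simp [dkFactor, offDiag]
  have e01 : (fun t => (dkFactor C (offDiag k₁ k₂) ρ ϑ t
      - dkFactor C (offDiag k₁ k₂) ρ' ϑ' t) 0 1)
      = fun t => k₁ * (1 / C * (ρ t * Complex.sinh (C * ϑ t)
        - ρ' t * Complex.sinh (C * ϑ' t))) := by
    funext t; simp [dkFactor, offDiag]; ring
  have e10 : (fun t => (dkFactor C (offDiag k₁ k₂) ρ ϑ t
      - dkFactor C (offDiag k₁ k₂) ρ' ϑ' t) 1 0)
      = fun t => k₂ * (1 / C * (ρ t * Complex.sinh (C * ϑ t)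
        - ρ' t * Complex.sinh (C * ϑ' t))) := by
    funext t; simp [dkFactor, offDiag]; ring
  rw [matL2norm, Fin.sum_univ_two, Fin.sum_univ_two, Fin.sum_univ_two, e00, e01, e10, e11]
  calc _ ≤ (ENNReal.ofReal s ^ 2 + ENNReal.ofReal (‖k₁‖ / ‖C‖ * s) ^ 2
        + (ENNReal.ofReal (‖k₂‖ / ‖C‖ * s) ^ 2 + ENNReal.ofReal s ^ 2)) ^ (1 / 2 : ℝ) := by
        gcongr
        exacts [b3 k₁, b3 k₂]
    _ = _ := by
        rw [← ENNReal.ofReal_pow hs0, ← ENNReal.ofReal_pow (by positivity),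
          ← ENNReal.ofReal_pow (by positivity), ← ENNReal.ofReal_add (by positivity) (by positivity),
          ← ENNReal.ofReal_add (by positivity) (by positivity),
          ← ENNReal.ofReal_add (by positivity) (by positivity),
          ENNReal.ofReal_rpow_of_nonneg (by positivity) (by norm_num), ← Real.sqrt_eq_rpow]
        congr 1
        rw [show s ^ 2 + (‖k₁‖ / ‖C‖ * s) ^ 2 + ((‖k₂‖ / ‖C‖ * s) ^ 2 + s ^ 2)
          = (2 + (‖k₁‖ ^ 2 + ‖k₂‖ ^ 2) / ‖C‖ ^ 2) * s ^ 2 by field_simp; ring,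
          Real.sqrt_mul (by positivity), Real.sqrt_sq hs0]

/-! ### Continuity and bounds for the factors -/

theorem IsWienerHopf.reflect {F Fp Fm : ℝ → ℂ} (h : IsWienerHopf F Fp Fm) :
    IsWienerHopf (fun t => F (-t)) (fun t => Fm (-t)) (fun t => Fp (-t)) where
  eq_mul t := by rw [h.eq_mul, mul_comm]
  plus := let ⟨_, hG, h0⟩ := h.minus; ⟨_, hG.reflect, fun z hz => h0 _ (by
    simpa [mem_closure_lower, mem_closure_upper] using hz)⟩
  minus := let ⟨_, hG, h0⟩ := h.plus; ⟨_, hG.reflect', fun z hz => h0 _ (by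
    simpa [mem_closure_lower, mem_closure_upper] using hz)⟩

theorem IsWienerHopf.continuous_plus {F Fp Fm : ℝ → ℂ} (h : IsWienerHopf F Fp Fm) :
    Continuous Fp := by
  obtain ⟨G, hG, -⟩ := h.plus
  exact (continuous_comp_ofReal hG.continuous).congr hG.boundary

theorem IsWienerHopf.continuous_minus {F Fp Fm : ℝ → ℂ} (h : IsWienerHopf F Fp Fm) :
    Continuous Fm := by
  simpa [Function.comp_def] using h.reflect.continuous_plus.comp continuous_neg

theorem ScalarFactors.exists_bounds {C : ℂ} {f : ℝ → ℂ} (F : ScalarFactors C f) :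
    ∃ R E : ℝ, F.BoundR R ∧ F.BoundE E := by
  obtain ⟨Gp, hGp, -⟩ := F.r_factors.plus
  obtain ⟨Gm, hGm, -⟩ := F.r_factors.minus
  obtain ⟨Tp, hTp⟩ := F.θ_parts.plus
  obtain ⟨Tm, hTm⟩ := F.θ_parts.minus
  obtain ⟨M₁, -, h₁⟩ := hGp.exists_norm_le
  obtain ⟨M₂, -, h₂⟩ := hGm.exists_norm_le
  obtain ⟨M₃, h₃0, h₃⟩ := hTp.exists_norm_le
  obtain ⟨M₄, h₄0, h₄⟩ := hTm.exists_norm_le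
  have aux : ∀ (z : ℂ) (M : ℝ), ‖z‖ ≤ M → M ≤ max M₃ M₄ →
      Real.cosh (C * z).re ≤ Real.cosh (‖C‖ * max M₃ M₄) := fun z M h1 h2 => by
    rw [Real.cosh_le_cosh, abs_of_nonneg (a := ‖C‖ * max M₃ M₄) (by positivity)]
    refine (Complex.abs_re_le_norm _).trans ?_
    rw [norm_mul]
    gcongr
    exact h1.trans h2
  refine ⟨max M₁ M₂, Real.cosh (‖C‖ * max M₃ M₄), fun t => ⟨?_, ?_⟩, fun t => ⟨?_, ?_⟩⟩
  · rw [← hGp.boundary]; exact (h₁ _ (ofReal_mem_closure_upper t)).trans (le_max_left _ _)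
  · rw [← hGm.boundary]; exact (h₂ _ (ofReal_mem_closure_lower t)).trans (le_max_right _ _)
  · rw [← hTp.boundary]; exact aux _ _ (h₃ _ (ofReal_mem_closure_upper t)) (le_max_left _ _)
  · rw [← hTm.boundary]; exact aux _ _ (h₄ _ (ofReal_mem_closure_lower t)) (le_max_right _ _)

/-! ### The Cauchy transform -/

/-- The Cauchy transform of a function on the real line. -/
noncomputable def cauchyTransform (ψ : ℝ → ℂ) (z : ℂ) : ℂ :=
  (2 * Real.pi * Complex.I)⁻¹ * ∫ t : ℝ, ψ t * (t - z)⁻¹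

theorem ofReal_sub_ne_zero {z : ℂ} (hz : z ∈ upper) (t : ℝ) : (t : ℂ) - z ≠ 0 := fun h => by
  have h1 := mem_upper.1 hz
  rw [← sub_eq_zero.1 h] at h1
  simp at h1

theorem continuous_kernel {z : ℂ} (hz : z ∈ upper) : Continuous fun t : ℝ => ((t : ℂ) - z)⁻¹ :=
  (by fun_prop : Continuous fun t : ℝ => (t : ℂ) - z).inv₀ (ofReal_sub_ne_zero hz)

theorem memLp_kernel {z : ℂ} (hz : z ∈ upper) :
    MemLp (fun t : ℝ => ((t : ℂ) - z)⁻¹) 2 volume := by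
  have hS : IsClosed (Set.range ((↑) : ℝ → ℂ)) := Complex.isometry_ofReal.isClosedEmbedding.isClosed_range
  have hne : ∀ w ∈ Set.range ((↑) : ℝ → ℂ), w - z ≠ 0 := by
    rintro _ ⟨t, rfl⟩; exact ofReal_sub_ne_zero hz t
  obtain ⟨M, -, hM⟩ := exists_decay_of_mul_sub hS (k := fun w => (w - z)⁻¹) (p := z) (M := 1)
    (ContinuousOn.inv₀ (by fun_prop) hne) fun w hw => by
      rw [norm_inv, inv_mul_cancel₀ (norm_ne_zero_iff.2 (hne w hw))]
  exact memLp_two_of_decay (continuous_kernel hz) fun t => by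
    simpa using hM _ (Set.mem_range_self t)

theorem integrable_kernel_sq {z : ℂ} (hz : z ∈ upper) :
    Integrable fun t : ℝ => ‖((t : ℂ) - z)⁻¹‖ ^ 2 :=
  (memLp_kernel hz).integrable_norm_pow two_ne_zero

theorem integrable_mul_kernel {ψ : ℝ → ℂ} (hψ : MemLp ψ 2 volume) {z : ℂ} (hz : z ∈ upper) :
    Integrable fun t : ℝ => ψ t * ((t : ℂ) - z)⁻¹ :=
  hψ.integrable_mul (memLp_kernel hz)

/-- Differentiation under the integral sign: on the disc of radius Im z₀/2 about z₀ one has |t - z|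
≥ |t - z₀|/2, so 4M|t - z₀|⁻² dominates the derivative. -/
theorem differentiableOn_cauchyTransform {ψ : ℝ → ℂ} (hc : Continuous ψ)
    (hψ : MemLp ψ 2 volume) {M : ℝ} (hM : ∀ t, ‖ψ t‖ ≤ M) :
    DifferentiableOn ℂ (cauchyTransform ψ) upper := by
  intro z₀ hz₀
  have hy := mem_upper.1 hz₀
  have hM0 : 0 ≤ M := (norm_nonneg _).trans (hM 0)
  have hball : ∀ z ∈ Metric.ball z₀ (z₀.im / 2), z ∈ upper := fun z hz => by
    rw [Metric.mem_ball, dist_eq_norm] at hz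
    have h1 := (neg_le_abs _).trans ((Complex.abs_im_le_norm (z - z₀)).trans hz.le)
    rw [Complex.sub_im] at h1
    rw [mem_upper]; linarith
  have key := hasDerivAt_integral_of_dominated_loc_of_deriv_le (μ := volume)
    (F := fun (z : ℂ) (t : ℝ) => ψ t * ((t : ℂ) - z)⁻¹)
    (F' := fun (z : ℂ) (t : ℝ) => ψ t * (((t : ℂ) - z) ^ 2)⁻¹)
    (bound := fun t : ℝ => M * 4 * ‖((t : ℂ) - z₀)⁻¹‖ ^ 2) (x₀ := z₀)
    (Metric.ball_mem_nhds z₀ (half_pos hy))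
    (by
      filter_upwards [isOpen_upper.mem_nhds hz₀] with z hz
      exact (integrable_mul_kernel hψ hz).aestronglyMeasurable)
    (integrable_mul_kernel hψ hz₀)
    (hc.mul (((continuous_kernel hz₀).pow 2).congr fun t =>
      inv_pow _ _)).aestronglyMeasurable
    (Eventually.of_forall fun t z hz => by
      have hz' := hball z hz
      rw [Metric.mem_ball, dist_eq_norm] at hz
      have h1 : z₀.im ≤ ‖(t : ℂ) - z₀‖ := by
        have := (neg_le_abs _).trans (Complex.abs_im_le_norm ((t : ℂ) - z₀))
        simpa using this
      have h2 : ‖(t : ℂ) - z₀‖ / 2 ≤ ‖(t : ℂ) - z‖ := by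
        have := norm_sub_norm_le ((t : ℂ) - z₀) (z - z₀)
        rw [sub_sub_sub_cancel_right] at this
        linarith
      have h3 : 0 < ‖(t : ℂ) - z₀‖ := hy.trans_le h1
      rw [norm_mul, mul_assoc]
      refine mul_le_mul (hM t) ?_ (norm_nonneg _) hM0
      rw [norm_inv, norm_pow, norm_inv, inv_pow, ← div_eq_mul_inv, inv_eq_one_div,
        div_le_div_iff₀ (pow_pos ((half_pos h3).trans_le h2) 2) (by positivity)]
      nlinarith)
    ((integrable_kernel_sq hz₀).const_mul _)
    (Eventually.of_forall fun t z hz => by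
      have hne := ofReal_sub_ne_zero (hball z hz) t
      have := ((hasDerivAt_id z).const_sub (t : ℂ)).inv hne
      simp only [id, neg_neg] at this
      rw [one_div] at this
      exact this.const_mul (ψ t))
  exact (key.2.const_mul _).differentiableAt.differentiableWithinAt

/-- After t ↦ -t the difference is a multiple of 1/((t + z)(t + z')), which is analytic in the upper
half-plane with quadratic decay. This permits subtracting a constant from the density in the Hölder
estimate. -/
theorem integral_kernel_sub_kernel {z z' : ℂ} (hz : z ∈ upper) (hz' : z' ∈ upper) :
    ∫ t : ℝ, (((t : ℂ) - z)⁻¹ - ((t : ℂ) - z')⁻¹) = 0 := by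
  have hne : ∀ {z : ℂ}, z ∈ upper → ∀ w ∈ closure upper, w + z ≠ 0 := fun {z} hz w hw h => by
    have h1 := mem_upper.1 hz
    have h2 := mem_closure_upper.1 hw
    have h3 := congrArg Complex.im h
    simp at h3
    linarith
  have hdec : ∀ {z : ℂ}, z ∈ upper → ∃ M, 0 ≤ M ∧ ∀ w ∈ closure upper,
      ‖(w + z)⁻¹‖ * (1 + ‖w‖) ≤ M := fun {z} hz =>
    exists_decay_of_mul_sub isClosed_closure (p := -z) (M := 1)
      (ContinuousOn.inv₀ (by fun_prop) (hne hz)) fun w hw => by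
        rw [sub_neg_eq_add, norm_inv, inv_mul_cancel₀ (norm_ne_zero_iff.2 (hne hz w hw))]
  obtain ⟨M, hM0, hM⟩ := hdec hz
  obtain ⟨M', -, hM'⟩ := hdec hz'
  have key := integral_ofReal_eq_zero (h := fun w => (w + z)⁻¹ * (w + z')⁻¹) (M := M * M')
    (DifferentiableOn.mul
      (DifferentiableOn.inv (by fun_prop) fun w hw => hne hz w (subset_closure hw))
      (DifferentiableOn.inv (by fun_prop) fun w hw => hne hz' w (subset_closure hw)))
    (ContinuousOn.mul (ContinuousOn.inv₀ (by fun_prop) (hne hz))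
      (ContinuousOn.inv₀ (by fun_prop) (hne hz')))
    fun w hw => by
      refine le_trans ?_ (mul_le_mul (hM w hw) (hM' w hw) (by positivity) hM0)
      rw [norm_mul, mul_mul_mul_comm ‖(w + z)⁻¹‖]
      gcongr
      nlinarith [norm_nonneg w]
  rw [← integral_neg_eq_self] at key
  have e : ∀ t : ℝ, (((t : ℂ) - z)⁻¹ - ((t : ℂ) - z')⁻¹)
      = (z - z') * ((((-t : ℝ) : ℂ) + z)⁻¹ * (((-t : ℝ) : ℂ) + z')⁻¹) := fun t => by
    have h1 := ofReal_sub_ne_zero hz t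
    have h2 := ofReal_sub_ne_zero hz' t
    rw [inv_sub_inv h1 h2, Complex.ofReal_neg, show -(t : ℂ) + z = -(t - z) by ring,
      show -(t : ℂ) + z' = -(t - z') by ring, inv_neg, inv_neg, neg_mul_neg, ← mul_inv,
      div_eq_mul_inv]
    ring
  simp_rw [e]
  rw [integral_const_mul, key, mul_zero]

/-- The dominating function in the Hölder estimate for the Cauchy transform. -/
noncomputable def holderKernel (β s : ℝ) : ℝ := |s| ^ (β - 1) * (2 * (1 + |s|)⁻¹)

/-- β > 0 gives integrability at 0, where the kernel is of order |s|^(β-1); β < 1 gives it at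
infinity, where it is of order |s|^(β-2). -/
theorem integrable_holderKernel {β : ℝ} (hβ : 0 < β) (hβ1 : β < 1) :
    Integrable (holderKernel β) := by
  have hm : Measurable (holderKernel β) := by unfold holderKernel; fun_prop
  suffices h : IntegrableOn (holderKernel β) (Set.Ioi 0) by
    have h' : IntegrableOn (holderKernel β) (Set.Iic 0) := by
      have hemb : MeasurableEmbedding fun x : ℝ => -x := (Homeomorph.neg ℝ).measurableEmbedding
      rw [← Measure.map_neg_eq_self (volume : Measure ℝ), hemb.integrableOn_map_iff]
      simp only [Function.comp_def, holderKernel, abs_neg, Set.neg_preimage,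
        Set.neg_Iic, neg_zero]
      exact Iff.mpr integrableOn_Ici_iff_integrableOn_Ioi h
    rw [← integrableOn_univ, ← Set.Iic_union_Ioi (a := (0 : ℝ))]
    exact h'.union h
  rw [← Set.Ioc_union_Ioi_eq_Ioi zero_le_one]
  refine IntegrableOn.union ?_ ?_
  · have h1 : IntegrableOn (fun s : ℝ => 2 * s ^ (β - 1)) (Set.Ioc 0 1) := by
      have := (intervalIntegral.intervalIntegrable_rpow' (a := 0) (b := 1) (r := β - 1)
        (by linarith)).const_mul 2
      rwa [intervalIntegrable_iff_integrableOn_Ioc_of_le zero_le_one] at this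
    refine h1.mono' hm.aestronglyMeasurable ((ae_restrict_mem measurableSet_Ioc).mono fun s hs => ?_)
    have hs0 : 0 < s := hs.1
    rw [holderKernel, abs_of_pos hs0, Real.norm_of_nonneg (by positivity), mul_comm 2 (s ^ (β - 1))]
    have := inv_le_one_of_one_le₀ (show 1 ≤ 1 + s by linarith)
    exact mul_le_mul_of_nonneg_left (by linarith) (by positivity)
  · have h1 : IntegrableOn (fun s : ℝ => 2 * s ^ (β - 2)) (Set.Ioi 1) :=
      (integrableOn_Ioi_rpow_of_lt (by linarith) one_pos).const_mul 2
    refine h1.mono' hm.aestronglyMeasurable ((ae_restrict_mem measurableSet_Ioi).mono fun s hs => ?_)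
    have hs0 : 0 < s := one_pos.trans hs
    rw [holderKernel, abs_of_pos hs0, Real.norm_of_nonneg (by positivity),
      show β - 2 = β - 1 - 1 by ring, Real.rpow_sub_one hs0.ne' (β - 1), div_eq_mul_inv,
      mul_left_comm]
    gcongr
    linarith

/-- The kernel difference has integral zero, so ψ(t) may be replaced by ψ(t) - ψ(Re z), which
absorbs the singularity at t = Re z. Substituting t = Re z + hs then extracts h^β. The bound does
not involve Im z, so it persists up to the real line. -/
theorem norm_cauchyTransform_sub_le {ψ : ℝ → ℂ} (hψ : MemLp ψ 2 volume) {A β : ℝ}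
    (hβ : 0 < β) (hβ1 : β < 1) (hA : ∀ x y, ‖ψ x - ψ y‖ ≤ A * |x - y| ^ β) {z : ℂ}
    (hz : z ∈ upper) {h : ℝ} (hh : 0 < h) :
    ‖cauchyTransform ψ z - cauchyTransform ψ (z + h * Complex.I)‖
      ≤ (2 * Real.pi)⁻¹ * A * (∫ s, holderKernel β s) * h ^ β := by
  have hz' := add_I_mem_upper hh.le hz
  set z' := z + h * Complex.I with hz'0
  have hA0 : 0 ≤ A := by
    have := (norm_nonneg _).trans (hA 1 0)
    simpa using this
  have hk : Integrable fun t : ℝ => ((t : ℂ) - z)⁻¹ - ((t : ℂ) - z')⁻¹ := by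
    have hb := (memLp_kernel hz).integrable_mul (memLp_kernel hz')
    refine (hb.const_mul (z - z')).congr (Eventually.of_forall fun t => ?_)
    have h1 := ofReal_sub_ne_zero hz t
    have h2 := ofReal_sub_ne_zero hz' t
    simp only [Pi.mul_apply]
    field_simp
    ring
  have e : cauchyTransform ψ z - cauchyTransform ψ z' = (2 * Real.pi * Complex.I)⁻¹ *
      ∫ t : ℝ, (ψ t - ψ z.re) * (((t : ℂ) - z)⁻¹ - ((t : ℂ) - z')⁻¹) := by
    have i1 := integral_sub (integrable_mul_kernel hψ hz) (integrable_mul_kernel hψ hz')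
    have i2 : ∫ t : ℝ, ψ z.re * (((t : ℂ) - z)⁻¹ - ((t : ℂ) - z')⁻¹) = 0 := by
      rw [integral_const_mul, integral_kernel_sub_kernel hz hz', mul_zero]
    have i3 := integral_sub ((integrable_mul_kernel hψ hz).sub (integrable_mul_kernel hψ hz'))
      (hk.const_mul (ψ z.re))
    rw [cauchyTransform, cauchyTransform, ← mul_sub, ← i1]
    congr 1
    rw [i2, sub_zero] at i3
    rw [show (∫ t : ℝ, (ψ t * ((t : ℂ) - z)⁻¹ - ψ t * ((t : ℂ) - z')⁻¹)) = _ from i3.symm]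
    refine integral_congr_ae (Eventually.of_forall fun t => ?_)
    simp only [Pi.sub_apply]
    ring
  have hbound : ∀ t : ℝ, ‖(ψ t - ψ z.re) * (((t : ℂ) - z)⁻¹ - ((t : ℂ) - z')⁻¹)‖
      ≤ A * h ^ (β - 1) * holderKernel β ((t - z.re) / h) := fun t => by
    have hzim := mem_upper.1 hz
    by_cases ht : t = z.re
    · rw [ht, sub_self, zero_mul, norm_zero, holderKernel]; positivity
    have hu : 0 < |t - z.re| := abs_pos.2 (sub_ne_zero.2 ht)
    have h1 := ofReal_sub_ne_zero hz t
    have h2 := ofReal_sub_ne_zero hz' t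
    have n1 : |t - z.re| ≤ ‖(t : ℂ) - z‖ := by
      simpa using Complex.abs_re_le_norm ((t : ℂ) - z)
    have n2 : |t - z.re| ≤ ‖(t : ℂ) - z'‖ := by
      simpa [hz'0] using Complex.abs_re_le_norm ((t : ℂ) - z')
    have n3 : h ≤ ‖(t : ℂ) - z'‖ := by
      have := (neg_le_abs _).trans (Complex.abs_im_le_norm ((t : ℂ) - z'))
      simp [hz'0] at this
      linarith
    have e1 : ((t : ℂ) - z)⁻¹ - ((t : ℂ) - z')⁻¹ = -(h * Complex.I) / ((t - z) * (t - z')) := by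
      rw [inv_sub_inv h1 h2, hz'0]; congr 1; ring
    rw [norm_mul, e1, norm_div, norm_neg, norm_mul, norm_mul, Complex.norm_I, mul_one,
      Complex.norm_real, Real.norm_of_nonneg hh.le, holderKernel, abs_div, abs_of_pos hh,
      Real.div_rpow hu.le hh.le]
    -- Being at least h and at least |t - Re z|, the modulus |t - z'| is at least their mean.
    calc ‖ψ t - ψ z.re‖ * (h / (‖(t : ℂ) - z‖ * ‖(t : ℂ) - z'‖))
        ≤ A * |t - z.re| ^ β * (h / (|t - z.re| * ((h + |t - z.re|) / 2))) := by
          gcongr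
          · exact hA _ _
          · linarith
      _ = A * h ^ (β - 1) * (|t - z.re| ^ (β - 1) / h ^ (β - 1) *
          (2 * (1 + |t - z.re| / h)⁻¹)) := by
          have hp : 0 < h ^ (β - 1) := by positivity
          rw [Real.rpow_sub_one hu.ne']
          field_simp
  have hint : Integrable fun t : ℝ => A * h ^ (β - 1) * holderKernel β ((t - z.re) / h) := by
    refine Integrable.const_mul ?_ _
    exact ((integrable_holderKernel hβ hβ1).comp_div hh.ne').comp_sub_right z.re
  have hval : ∫ t : ℝ, A * h ^ (β - 1) * holderKernel β ((t - z.re) / h)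
      = A * (∫ s, holderKernel β s) * h ^ β := by
    rw [integral_const_mul, integral_sub_right_eq_self (fun t => holderKernel β (t / h)),
      Measure.integral_comp_div, abs_of_pos hh, smul_eq_mul, Real.rpow_sub_one hh.ne']
    field_simp
  have hn := norm_integral_le_of_norm_le hint (Eventually.of_forall hbound)
  rw [hval] at hn
  rw [e, norm_mul]
  have hpi : ‖(2 * Real.pi * Complex.I : ℂ)⁻¹‖ = (2 * Real.pi)⁻¹ := by
    simp [abs_of_pos Real.pi_pos]
  rw [hpi]
  calc _ ≤ (2 * Real.pi)⁻¹ * (A * (∫ s, holderKernel β s) * h ^ β) := by gcongr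
    _ = _ := by ring

/-- On [-T, T] the kernel is at most 1/(|z| - T); outside, ab ≤ λa² + λ⁻¹b². The weight λ lets the
tail of ψ pay for the kernel, whose L₂ norm need not be small. -/
theorem norm_kernel_integral_le_split {ψ : ℝ → ℂ} (hψ : MemLp ψ 2 volume)
    {M : ℝ} (hM : ∀ t, ‖ψ t‖ ≤ M) {z : ℂ} (hz : z ∈ upper) {T lam : ℝ} (hT : 0 ≤ T)
    (hlam : 0 < lam) (hzT : T < ‖z‖) :
    ‖∫ t : ℝ, ψ t * ((t : ℂ) - z)⁻¹‖ ≤ M / (‖z‖ - T) * (2 * T)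
      + (lam * (∫ t in (Set.Icc (-T) T)ᶜ, ‖ψ t‖ ^ 2)
        + lam⁻¹ * ∫ t : ℝ, ‖((t : ℂ) - z)⁻¹‖ ^ 2) := by
  have hM0 : 0 ≤ M := (norm_nonneg _).trans (hM 0)
  rw [← integral_add_compl measurableSet_Icc (integrable_mul_kernel hψ hz) (s := Set.Icc (-T) T)]
  refine (norm_add_le _ _).trans (add_le_add ?_ ?_)
  · have := norm_setIntegral_le_of_norm_le_const (μ := volume) (s := Set.Icc (-T) T)
      (f := fun t : ℝ => ψ t * ((t : ℂ) - z)⁻¹) (C := M / (‖z‖ - T)) (by simp) fun t ht => by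
        rw [norm_mul, norm_inv, ← div_eq_mul_inv]
        have h1 : |t| ≤ T := abs_le.2 ht
        have h2 := norm_sub_norm_le z t
        rw [Complex.norm_real, Real.norm_eq_abs, norm_sub_rev] at h2
        have : 0 < ‖z‖ - T := sub_pos.2 hzT
        gcongr
        · exact hM t
        · linarith
    refine this.trans (le_of_eq ?_)
    rw [measureReal_def, Real.volume_Icc, ENNReal.toReal_ofReal (by linarith)]
    ring
  · have iψ := hψ.integrable_norm_pow two_ne_zero
    have ik := integrable_kernel_sq hz
    have h1 : ∀ t : ℝ, ‖ψ t * ((t : ℂ) - z)⁻¹‖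
        ≤ lam * ‖ψ t‖ ^ 2 + lam⁻¹ * ‖((t : ℂ) - z)⁻¹‖ ^ 2 := fun t => by
      rw [norm_mul]
      generalize ‖ψ t‖ = a
      generalize ‖((t : ℂ) - z)⁻¹‖ = b
      have e : lam * a ^ 2 + lam⁻¹ * b ^ 2 - a * b
          = lam * (a - lam⁻¹ * b / 2) ^ 2 + lam⁻¹ * b ^ 2 * (3 / 4) := by
        field_simp; ring
      have : 0 ≤ lam * (a - lam⁻¹ * b / 2) ^ 2 + lam⁻¹ * b ^ 2 * (3 / 4) := by positivity
      linarith
    refine (norm_integral_le_of_norm_le (((iψ.const_mul lam).add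
      (ik.const_mul lam⁻¹)).integrableOn (s := (Set.Icc (-T) T)ᶜ)) (Eventually.of_forall h1)).trans ?_
    have h2 := integral_add (iψ.const_mul lam).integrableOn.integrable
      ((ik.const_mul lam⁻¹).integrableOn (s := (Set.Icc (-T) T)ᶜ)).integrable
    have h3 := integral_const_mul (μ := volume.restrict (Set.Icc (-T) T)ᶜ) lam fun t => ‖ψ t‖ ^ 2
    have h4 := setIntegral_le_integral (s := (Set.Icc (-T) T)ᶜ) (ik.const_mul lam⁻¹)
      (Eventually.of_forall fun t => by positivity)
    rw [integral_const_mul, integral_const_mul] at h4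
    refine h2.le.trans ?_
    rw [h3, integral_const_mul]
    exact add_le_add le_rfl h4

/-- Lifting by η bounds the L₂ norm of the kernel uniformly in z, which
`norm_kernel_integral_le_split` requires. -/
theorem tendsto_cauchyTransform_shift {ψ : ℝ → ℂ} (hψ : MemLp ψ 2 volume)
    {M : ℝ} (hM : ∀ t, ‖ψ t‖ ≤ M) {η : ℝ} (hη : 0 < η) :
    Tendsto (fun z => cauchyTransform ψ (z + η * Complex.I)) (cocompact ℂ ⊓ 𝓟 (closure upper))
      (𝓝 0) := by
  have hηu : (η * Complex.I : ℂ) ∈ upper := by rw [mem_upper]; simpa using hη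
  set K := ∫ t : ℝ, ‖((t : ℂ) - η * Complex.I)⁻¹‖ ^ 2 with hK
  have hK0 : 0 ≤ K := integral_nonneg fun _ => by positivity
  have hup : ∀ z ∈ closure upper, z + η * Complex.I ∈ upper := fun z hz => by
    have := mem_closure_upper.1 hz
    rw [mem_upper]; simp; linarith
  have hKle : ∀ z ∈ closure upper, ∫ t : ℝ, ‖((t : ℂ) - (z + η * Complex.I))⁻¹‖ ^ 2 ≤ K := by
    intro z hz
    rw [hK, ← integral_sub_right_eq_self
      (fun t : ℝ => ‖((t : ℂ) - η * Complex.I)⁻¹‖ ^ 2) z.re]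
    refine integral_mono (integrable_kernel_sq (hup z hz))
      ((integrable_kernel_sq hηu).comp_sub_right z.re) fun t => ?_
    have h1 := ofReal_sub_ne_zero hηu (t - z.re)
    have h2 := mem_closure_upper.1 hz
    simp only [norm_inv]
    gcongr
    rw [← sq_le_sq₀ (norm_nonneg _) (norm_nonneg _), Complex.sq_norm, Complex.sq_norm,
      Complex.normSq_apply, Complex.normSq_apply]
    simp
    nlinarith
  have iψ := hψ.integrable_norm_pow two_ne_zero
  have htail : Tendsto (fun T : ℝ => ∫ t in (Set.Icc (-T) T)ᶜ, ‖ψ t‖ ^ 2) atTop (𝓝 0) := by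
    have h1 := (intervalIntegral_tendsto_integral iψ tendsto_neg_atTop_atBot tendsto_id).const_sub
      (∫ t, ‖ψ t‖ ^ 2)
    rw [sub_self] at h1
    refine h1.congr' ?_
    filter_upwards [eventually_ge_atTop 0] with T hT
    rw [← integral_add_compl measurableSet_Icc iψ (s := Set.Icc (-T) T),
      intervalIntegral.integral_of_le (by simp only [id]; linarith),
      ← integral_Icc_eq_integral_Ioc, id, add_sub_cancel_left]
  suffices h : Tendsto (fun z => ∫ t : ℝ, ψ t * ((t : ℂ) - (z + η * Complex.I))⁻¹)
      (cocompact ℂ ⊓ 𝓟 (closure upper)) (𝓝 0) by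
    have := h.const_mul (2 * Real.pi * Complex.I : ℂ)⁻¹
    rwa [mul_zero] at this
  rw [Metric.tendsto_nhds]
  intro e he
  -- Order of choices: λ makes the kernel term at most e/3, then T the tail term, then large |z| the
  -- term from [-T, T].
  set lam := 3 * (K + 1) / e with hlam
  have hlam0 : 0 < lam := by positivity
  obtain ⟨T, hT1, hT0⟩ := ((htail.eventually (gt_mem_nhds
    (show 0 < e / (3 * lam) by positivity))).and (eventually_ge_atTop 0)).exists
  have hn : Tendsto (fun z : ℂ => ‖z + η * Complex.I‖) (cocompact ℂ ⊓ 𝓟 (closure upper)) atTop :=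
    (tendsto_norm_cocompact_atTop.mono_left inf_le_left).comp
      (tendsto_add_const_cocompact η hη.le)
  have hlim : Tendsto (fun z : ℂ => M / (‖z + η * Complex.I‖ - T) * (2 * T))
      (cocompact ℂ ⊓ 𝓟 (closure upper)) (𝓝 0) := by
    have := (tendsto_const_nhds (x := M)).div_atTop (tendsto_atTop_add_const_right _ (-T) hn)
    simpa [sub_eq_add_neg] using this.mul_const (2 * T)
  filter_upwards [hlim.eventually (gt_mem_nhds (show 0 < e / 3 by positivity)),
    hn.eventually_gt_atTop T, mem_inf_of_right (mem_principal_self _)] with z hz1 hz2 hz3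
  rw [dist_zero_right]
  refine (norm_kernel_integral_le_split hψ hM (hup z hz3) hT0 hlam0 hz2).trans_lt ?_
  have h1 : lam * (∫ t in (Set.Icc (-T) T)ᶜ, ‖ψ t‖ ^ 2) ≤ e / 3 := by
    refine (mul_le_mul_of_nonneg_left hT1.le hlam0.le).trans (le_of_eq ?_)
    field_simp
  have h2 : lam⁻¹ * (∫ t : ℝ, ‖((t : ℂ) - (z + η * Complex.I))⁻¹‖ ^ 2) ≤ e / 3 := by
    refine (mul_le_mul_of_nonneg_left (hKle z hz3) (by positivity)).trans ?_
    rw [hlam, inv_div, div_mul_eq_mul_div, div_le_div_iff₀ (by positivity) (by positivity)]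
    nlinarith
  linarith

/-- The defining integral is singular on the real line, so boundary values are obtained by shifting
up by 1/(n + 1). The Hölder estimate makes these shifts uniformly Cauchy on the closed half-plane;
the limit is therefore continuous there, agrees with the transform inside, and inherits the limit 0
at infinity. -/
theorem exists_isExtension_cauchyTransform {ψ : ℝ → ℂ} (hc : Continuous ψ)
    (hψ : MemLp ψ 2 volume) {M : ℝ} (hM : ∀ t, ‖ψ t‖ ≤ M) {A β : ℝ}
    (hβ : 0 < β) (hβ1 : β < 1) (hA : ∀ x y, ‖ψ x - ψ y‖ ≤ A * |x - y| ^ β) :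
    ∃ G, IsExtension upper (fun t => G t) 0 G ∧ ∀ t : ℝ, Tendsto
      (fun n : ℕ => cauchyTransform ψ (t + (1 / ((n : ℝ) + 1) : ℝ) * Complex.I)) atTop
      (𝓝 (G t)) := by
  set η : ℕ → ℝ := fun n => 1 / ((n : ℝ) + 1) with hη
  have hη0 : ∀ n, 0 < η n := fun n => by positivity
  have hηl : Tendsto η atTop (𝓝 0) := tendsto_one_div_add_atTop_nhds_zero_nat
  set F : ℕ → ℂ → ℂ := fun n z => cauchyTransform ψ (z + η n * Complex.I) with hF
  have hup : ∀ n, ∀ z ∈ closure upper, z + η n * Complex.I ∈ upper := fun n z hz => by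
    have h1 := mem_closure_upper.1 hz
    have h2 := hη0 n
    rw [mem_upper]; simp only [Complex.add_im, Complex.mul_im, Complex.ofReal_re, Complex.I_im,
      mul_one, Complex.ofReal_im, Complex.I_re, mul_zero, add_zero]; linarith
  have hdiff := differentiableOn_cauchyTransform hc hψ hM
  have hFc : ∀ n, ContinuousOn (F n) (closure upper) := fun n =>
    hdiff.continuousOn.comp (by fun_prop) fun z hz => hup n z hz
  set B := (2 * Real.pi)⁻¹ * A * (∫ s, holderKernel β s) with hB
  have hstep : ∀ n m, ∀ z ∈ closure upper, η n < η m →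
      ‖F n z - F m z‖ ≤ B * (η m - η n) ^ β := fun n m z hz hnm => by
    have := norm_cauchyTransform_sub_le hψ hβ hβ1 hA (hup n z hz) (sub_pos.2 hnm)
    rwa [add_assoc, ← add_mul, ← Complex.ofReal_add, add_sub_cancel] at this
  have hdist : ∀ n m, ∀ z ∈ closure upper, dist (F n z) (F m z) ≤ |B| * |η n - η m| ^ β := by
    intro n m z hz
    rw [dist_eq_norm]
    rcases lt_trichotomy (η n) (η m) with h | h | h
    · rw [abs_sub_comm, abs_of_pos (sub_pos.2 h)]
      exact (hstep n m z hz h).trans (by gcongr; exact le_abs_self B)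
    · simp only [hF, h, sub_self, norm_zero]; positivity
    · rw [norm_sub_rev, abs_of_pos (sub_pos.2 h)]
      exact (hstep m n z hz h).trans (by gcongr; exact le_abs_self B)
  have hcau : UniformCauchySeqOn F atTop (closure upper) := by
    rw [Metric.uniformCauchySeqOn_iff]
    intro e he
    have hlim : Tendsto (fun p : ℕ × ℕ => |B| * |η p.1 - η p.2| ^ β) (atTop ×ˢ atTop) (𝓝 0) := by
      have h1 : Tendsto (fun p : ℕ × ℕ => |η p.1 - η p.2|) (atTop ×ˢ atTop) (𝓝 0) := by
        have := ((hηl.comp tendsto_fst).sub (hηl.comp tendsto_snd) :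
          Tendsto _ ((atTop : Filter ℕ) ×ˢ (atTop : Filter ℕ)) _).abs
        simpa using this
      have h2 := (h1.rpow_const (p := β) (Or.inr hβ.le)).const_mul |B|
      rwa [Real.zero_rpow hβ.ne', mul_zero] at h2
    have hev := hlim.eventually (gt_mem_nhds he)
    rw [prod_atTop_atTop_eq, eventually_atTop] at hev
    obtain ⟨⟨a, b⟩, hab⟩ := hev
    refine ⟨max a b, fun m hm n hn z hz => (hdist m n z hz).trans_lt (hab (m, n) ?_)⟩
    exact ⟨(le_max_left _ _).trans hm, (le_max_right _ _).trans hn⟩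
  have hex : ∀ z, ∃ w, z ∈ closure upper → Tendsto (fun n => F n z) atTop (𝓝 w) := fun z => by
    by_cases hz : z ∈ closure upper
    · obtain ⟨w, hw⟩ := cauchySeq_tendsto_of_complete (hcau.cauchySeq hz)
      exact ⟨w, fun _ => hw⟩
    · exact ⟨0, fun h => absurd h hz⟩
  choose G hG using hex
  have hunif : TendstoUniformlyOn F G atTop (closure upper) :=
    hcau.tendstoUniformlyOn_of_tendsto hG
  have heq : Set.EqOn G (cauchyTransform ψ) upper := fun z hz => by
    have h1 : Tendsto (fun n => z + η n * Complex.I) atTop (𝓝 z) := by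
      have := (((Complex.continuous_ofReal.tendsto _).comp hηl).mul_const Complex.I).const_add z
      simpa using this
    exact tendsto_nhds_unique (hG z (subset_closure hz))
      ((hdiff.differentiableAt (isOpen_upper.mem_nhds hz)).continuousAt.tendsto.comp h1)
  refine ⟨G, ⟨hdiff.congr heq, hunif.continuousOn (Frequently.of_forall hFc), ?_, fun _ => rfl⟩,
    fun t => hG t (ofReal_mem_closure_upper t)⟩
  rw [Metric.tendsto_nhds]
  intro e he
  obtain ⟨n, hn⟩ := (Metric.tendstoUniformlyOn_iff.1 hunif (e / 2) (half_pos he)).exists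
  filter_upwards [(tendsto_cauchyTransform_shift hψ hM (hη0 n)).eventually
    (Metric.ball_mem_nhds 0 (half_pos he)), mem_inf_of_right (mem_principal_self _)] with z hz1 hz2
  have h1 := hn z hz2
  have h2 := dist_triangle (G z) (F n z) 0
  change dist (F n z) 0 < e / 2 at hz1
  linarith

/-- The reflected transform stands for the lower half-plane part, and the two kernels add up to a
Poisson kernel: 1/(t - z) - 1/(t - z̄) = 2iy/((t - x)² + y²). Letting y → 0 gives the Plemelj jump
formula. -/
theorem cauchyTransform_add_reflect {ψ : ℝ → ℂ} (hψ : MemLp ψ 2 volume)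
    (hψ' : MemLp (fun t => ψ (-t)) 2 volume) (x : ℝ) {y : ℝ} (hy : 0 < y) :
    cauchyTransform ψ (x + y * Complex.I)
      + cauchyTransform (fun t => ψ (-t)) ((-x : ℝ) + y * Complex.I)
      = (Real.pi : ℂ)⁻¹ * ∫ s : ℝ, ψ (x + y * s) * ((1 + s ^ 2)⁻¹ : ℝ) := by
  have hz : (x + y * Complex.I : ℂ) ∈ upper := by rw [mem_upper]; simpa using hy
  have hz' : ((-x : ℝ) + y * Complex.I : ℂ) ∈ upper := by rw [mem_upper]; simpa using hy
  have i2 := integrable_mul_kernel hψ' hz'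
  have e2 : ∫ t : ℝ, ψ (-t) * ((t : ℂ) - ((-x : ℝ) + y * Complex.I))⁻¹
      = ∫ t : ℝ, ψ t * (((-t : ℝ) : ℂ) - ((-x : ℝ) + y * Complex.I))⁻¹ := by
    rw [← integral_neg_eq_self]
    simp only [neg_neg]
  have i2' := i2.comp_neg
  simp only [neg_neg] at i2'
  rw [cauchyTransform, cauchyTransform, e2, ← mul_add,
    ← integral_add (integrable_mul_kernel hψ hz) i2']
  set P : ℝ → ℂ := fun t => ψ t * ((y⁻¹ * (1 + ((t - x) / y) ^ 2)⁻¹ : ℝ) : ℂ) with hP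
  have e3 : ∀ t : ℝ, ψ t * ((t : ℂ) - (x + y * Complex.I))⁻¹
      + ψ t * (((-t : ℝ) : ℂ) - ((-x : ℝ) + y * Complex.I))⁻¹ = 2 * Complex.I * P t := fun t => by
    have h1 := ofReal_sub_ne_zero hz t
    have h2 := ofReal_sub_ne_zero hz' (-t)
    have h3 : ((y : ℂ) ^ 2 + (t - x) ^ 2) ≠ 0 := by
      have : 0 < y ^ 2 + (t - x) ^ 2 := by positivity
      exact_mod_cast this.ne'
    have hy' : (y : ℂ) ≠ 0 := by exact_mod_cast hy.ne'
    have h4 : ((t : ℂ) - (x + y * Complex.I)) * (((-t : ℝ) : ℂ) - ((-x : ℝ) + y * Complex.I))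
        = -((y : ℂ) ^ 2 + (t - x) ^ 2) := by
      push_cast
      linear_combination (y : ℂ) ^ 2 * Complex.I_sq
    have h5 : ((y⁻¹ * (1 + ((t - x) / y) ^ 2)⁻¹ : ℝ) : ℂ) = y / ((y : ℂ) ^ 2 + (t - x) ^ 2) := by
      push_cast
      field_simp
    simp only [hP]
    rw [h5, ← mul_add, inv_add_inv h1 h2, h4]
    push_cast
    field_simp
    ring
  rw [integral_congr_ae (Eventually.of_forall e3), integral_const_mul]
  have e4 : ∫ s : ℝ, ψ (x + y * s) * ((1 + s ^ 2)⁻¹ : ℝ) = ∫ t, P t := by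
    have h1 : ∀ s : ℝ, ψ (x + y * s) * ((1 + s ^ 2)⁻¹ : ℝ) = y * P (x + y * s) := fun s => by
      have hy' : (y : ℂ) ≠ 0 := by exact_mod_cast hy.ne'
      simp only [hP, add_sub_cancel_left, mul_div_cancel_left₀ s hy.ne']
      push_cast
      field_simp
    simp_rw [h1]
    rw [integral_const_mul, Measure.integral_comp_mul_left (fun t => P (x + t)),
      integral_add_left_eq_self, abs_of_pos (by positivity), ← Complex.real_smul, smul_smul,
      mul_inv_cancel₀ hy.ne', one_smul]
  rw [e4, ← mul_assoc]
  congr 1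
  have := Complex.I_ne_zero
  field_simp

theorem tendsto_poisson {ψ : ℝ → ℂ} (hc : Continuous ψ) {M : ℝ} (hM : ∀ t, ‖ψ t‖ ≤ M) (x : ℝ)
    {y : ℕ → ℝ} (hy : Tendsto y atTop (𝓝 0)) :
    Tendsto (fun n => (Real.pi : ℂ)⁻¹ * ∫ s : ℝ, ψ (x + y n * s) * ((1 + s ^ 2)⁻¹ : ℝ)) atTop
      (𝓝 (ψ x)) := by
  have hw : Continuous fun s : ℝ => (((1 + s ^ 2)⁻¹ : ℝ) : ℂ) :=
    Complex.continuous_ofReal.comp (Continuous.inv₀ (by fun_prop) fun s => by positivity)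
  have key := tendsto_integral_of_dominated_convergence (μ := volume)
    (F := fun n s => ψ (x + y n * s) * ((1 + s ^ 2)⁻¹ : ℝ))
    (f := fun s : ℝ => ψ x * ((1 + s ^ 2)⁻¹ : ℝ)) (fun s => M * (1 + s ^ 2)⁻¹)
    (fun n => ((hc.comp (by fun_prop)).mul hw).aestronglyMeasurable)
    (integrable_inv_one_add_sq.const_mul M)
    (fun n => Eventually.of_forall fun s => by
      rw [norm_mul, Complex.norm_real, Real.norm_of_nonneg (by positivity)]
      gcongr
      exact hM _)
    (Eventually.of_forall fun s => by
      refine Tendsto.mul_const _ ((hc.tendsto x).comp ?_)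
      have := (hy.mul_const s).const_add x
      simpa using this)
  rw [integral_const_mul, integral_complex_ofReal, integral_univ_inv_one_add_sq] at key
  have := key.const_mul (Real.pi : ℂ)⁻¹
  rwa [mul_left_comm, inv_mul_cancel₀ (by exact_mod_cast Real.pi_ne_zero), mul_one] at this

/-- Bounded Hölder continuous functions in `L₂` split additively. -/
theorem exists_isAdditiveSplitting {ψ : ℝ → ℂ} (hc : Continuous ψ)
    (hψ : MemLp ψ 2 volume) {M : ℝ} (hM : ∀ t, ‖ψ t‖ ≤ M) {A β : ℝ}
    (hβ : 0 < β) (hβ1 : β < 1) (hA : ∀ x y, ‖ψ x - ψ y‖ ≤ A * |x - y| ^ β) :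
    ∃ ψp ψm, IsAdditiveSplitting ψ ψp ψm := by
  have hψ' : MemLp (fun t => ψ (-t)) 2 volume :=
    hψ.comp_measurePreserving (Measure.measurePreserving_neg volume)
  obtain ⟨G, hG, hGl⟩ := exists_isExtension_cauchyTransform hc hψ hM hβ hβ1 hA
  obtain ⟨G', hG', hGl'⟩ := exists_isExtension_cauchyTransform (ψ := fun t => ψ (-t))
    (hc.comp continuous_neg) hψ' (fun t => hM (-t)) hβ hβ1 fun x y => by
      have := hA (-x) (-y)
      rwa [neg_sub_neg, abs_sub_comm] at this
  refine ⟨fun t => G t, fun t => G' ((-t : ℝ) : ℂ), fun t => ?_, ⟨G, hG⟩, ⟨_, hG'.reflect'⟩⟩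
  have h1 := (hGl t).add (hGl' (-t))
  refine tendsto_nhds_unique ?_ h1
  refine (tendsto_poisson hc hM t tendsto_one_div_add_atTop_nhds_zero_nat).congr fun n => ?_
  rw [← cauchyTransform_add_reflect hψ hψ' t (by positivity)]

/-! ### Existence of scalar factors -/

/-- Index zero makes the argument tend to the same a at both ends, and g → 1 forces e^(ia) = 1;
hence log|g| + i(φ - a) is a logarithm vanishing at both ends. -/
theorem HasIndex.exists_log {g : ℝ → ℂ} (h : HasIndex g 0)
    (hg : Tendsto g (cocompact ℝ) (𝓝 1)) : ∃ ψ : ℝ → ℂ, Continuous ψ ∧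
      Tendsto ψ (cocompact ℝ) (𝓝 0) ∧ ∀ t, Complex.exp (ψ t) = g t := by
  obtain ⟨hc, h0, φ, hφ, hgφ, a, b, ha, hb, hab⟩ := h
  have hab' : a = b := by
    have := (mul_eq_zero.1 hab).resolve_left (by positivity)
    linarith
  subst hab'
  have hφl : Tendsto φ (cocompact ℝ) (𝓝 a) := by
    rw [cocompact_eq_atBot_atTop]; exact hb.sup ha
  have hexp : ∀ x : ℂ, Continuous fun y : ℝ => Complex.exp ((y - x) * Complex.I) := fun x => by
    fun_prop
  have hea : Complex.exp (a * Complex.I) = 1 := by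
    have h1 : Tendsto (fun t => (‖g t‖ : ℂ) * Complex.exp ((φ t : ℂ) * Complex.I)) (cocompact ℝ)
        (𝓝 ((‖(1 : ℂ)‖ : ℂ) * Complex.exp (a * Complex.I))) :=
      ((Complex.continuous_ofReal.tendsto _).comp hg.norm).mul
        (by simpa [Function.comp_def] using ((hexp 0).tendsto a).comp hφl)
    have h2 := tendsto_nhds_unique (h1.congr fun t => (hgφ t).symm) hg
    simpa using h2
  refine ⟨fun t => (Real.log ‖g t‖ : ℝ) + (φ t - a) * Complex.I, ?_, ?_, fun t => ?_⟩
  · refine (Complex.continuous_ofReal.comp (hc.norm.log fun t => norm_ne_zero_iff.2 (h0 t))).add ?_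
    fun_prop
  · have h1 : Tendsto (fun t => ((Real.log ‖g t‖ : ℝ) : ℂ)) (cocompact ℝ) (𝓝 0) := by
      have := (Complex.continuous_ofReal.tendsto _).comp (hg.norm.log (by simp))
      simpa [Function.comp_def] using this
    have h2 : Tendsto (fun t => (φ t - a : ℂ) * Complex.I) (cocompact ℝ) (𝓝 0) := by
      have := (((Complex.continuous_ofReal.tendsto _).comp hφl).sub_const (a : ℂ)).mul_const
        Complex.I
      simpa using this
    simpa using h1.add h2
  · rw [Complex.exp_add, sub_mul, Complex.exp_sub, hea, div_one, ← Complex.ofReal_exp,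
      Real.exp_log (norm_pos_iff.2 (h0 t)), ← hgφ]

/-- Adding the principal logarithm of g'/g transfers the logarithm, so no index assumption on the
perturbed function is needed. -/
theorem exists_log_of_close {g g' ψ : ℝ → ℂ} (hψ : Continuous ψ)
    (hψl : Tendsto ψ (cocompact ℝ) (𝓝 0)) (he : ∀ t, Complex.exp (ψ t) = g t)
    (hg' : Continuous g') (hgl' : Tendsto g' (cocompact ℝ) (𝓝 1))
    (hclose : ∀ t, ‖g' t / g t - 1‖ ≤ 1 / 2) :
    ∃ ψ' : ℝ → ℂ, Continuous ψ' ∧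
      Tendsto ψ' (cocompact ℝ) (𝓝 0) ∧ ∀ t, Complex.exp (ψ' t) = g' t := by
  have hg0 : ∀ t, g t ≠ 0 := fun t => by rw [← he]; exact Complex.exp_ne_zero _
  have hgc : Continuous g := hψ.cexp.congr he
  have hgl : Tendsto g (cocompact ℝ) (𝓝 1) := by simpa using hψl.cexp.congr he
  refine ⟨fun t => ψ t + Complex.log (g' t / g t), hψ.add ((hg'.div hgc hg0).clog fun t =>
    mem_slitPlane_of_norm_sub_one_le (hclose t)), ?_, fun t => ?_⟩
  · have := hψl.add ((hgl'.div hgl one_ne_zero).clog (by simp))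
    simpa using this
  · have h1 : g' t / g t ≠ 0 := fun h => by
      have := hclose t
      rw [h, zero_sub, norm_neg, norm_one] at this
      norm_num at this
    rw [Complex.exp_add, Complex.exp_log h1, he, mul_div_cancel₀ _ (hg0 t)]

/-- Near infinity ψ is a principal logarithm and |ψ| ≤ (3/2)D|f|; on the remaining compact set
boundedness suffices. -/
theorem memLp_log {f g ψ : ℝ → ℂ} (hf : MemLp f 2 volume) (hψ : Continuous ψ)
    (hψl : Tendsto ψ (cocompact ℝ) (𝓝 0)) (he : ∀ t, Complex.exp (ψ t) = g t) {D : ℝ}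
    (hD : ∀ t, ‖g t - 1‖ ≤ D * ‖f t‖) {M : ℝ} (hM : ∀ t, ‖ψ t‖ ≤ M) : MemLp ψ 2 volume := by
  have hM0 : 0 ≤ M := (norm_nonneg _).trans (hM 0)
  have hev : ∀ᶠ t in cocompact ℝ, ‖ψ t‖ ≤ 3 / 2 * (D * ‖f t‖) := by
    have h1 : ∀ᶠ t in cocompact ℝ, |(ψ t).im| < Real.pi := by
      have h := ((Complex.continuous_im.tendsto _).comp hψl).abs
      simp only [Complex.zero_im, abs_zero] at h
      exact h.eventually (gt_mem_nhds Real.pi_pos)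
    have h2 : ∀ᶠ t in cocompact ℝ, ‖Complex.exp (ψ t) - 1‖ < 1 / 2 := by
      have := (hψl.cexp.sub_const 1).norm
      rw [Complex.exp_zero, sub_self, norm_zero] at this
      exact this.eventually (gt_mem_nhds (by norm_num))
    filter_upwards [h1, h2] with t h1 h2
    -- On a one-point set the branch is fixed by |Im ψ(t)| < π alone.
    refine (norm_le_of_norm_exp_sub_one_le (S := {t}) isPreconnected_singleton
      (continuousOn_singleton ψ t) (by rintro _ rfl; exact h2.le) rfl h1 t rfl).trans ?_
    rw [he]
    gcongr
    exact hD t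
  obtain ⟨K, hK, hKs⟩ := mem_cocompact.1 hev
  have hKm : MemLp (K.indicator fun _ => M) 2 volume :=
    memLp_indicator_const 2 hK.measurableSet M (Or.inr hK.measure_lt_top.ne)
  refine ((hf.norm.const_mul (3 / 2 * |D|)).add hKm).mono' hψ.aestronglyMeasurable
    (Eventually.of_forall fun t => ?_)
  simp only [Pi.add_apply]
  by_cases ht : t ∈ K
  · rw [Set.indicator_of_mem ht]
    have : 0 ≤ 3 / 2 * |D| * ‖f t‖ := by positivity
    linarith [hM t]
  · rw [Set.indicator_of_notMem ht, add_zero, mul_assoc]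
    refine (hKs ht).trans ?_
    gcongr
    exact le_abs_self D

/-- For |x - y| ≤ η the quotient g/g(y) stays within 1/2 of 1 along the segment, so ψ inherits the
Hölder bound of f; for larger distances 2M suffices. The exponent is lowered to at most 1/2 because
the Cauchy transform estimate needs β < 1; η ≤ 1 makes the lowering harmless. -/
theorem exists_holder_log {f g ψ : ℝ → ℂ} {H α : ℝ≥0} (hα : 0 < α) (hf : HolderWith H α f)
    (hψ : Continuous ψ) (he : ∀ t, Complex.exp (ψ t) = g t) {c B : ℝ} (hc : 0 < c) (hB0 : 0 ≤ B)
    (hg : ∀ t, c ≤ ‖g t‖) (hB : ∀ x y, ‖g x - g y‖ ≤ B * ‖f x - f y‖)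
    {M : ℝ} (hM : ∀ t, ‖ψ t‖ ≤ M) :
    ∃ A β : ℝ, 0 < β ∧ β < 1 ∧ ∀ x y, ‖ψ x - ψ y‖ ≤ A * |x - y| ^ β := by
  have hM0 : 0 ≤ M := (norm_nonneg _).trans (hM 0)
  have hα' : 0 < (α : ℝ) := hα
  have hlim : Tendsto (fun η : ℝ => B * (H * η ^ (α : ℝ)) / c) (𝓝[>] 0) (𝓝 0) := by
    have h1 : ContinuousAt (fun η : ℝ => B * (H * η ^ (α : ℝ)) / c) 0 :=
      (continuousAt_const.mul (continuousAt_const.mul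
        (Real.continuousAt_rpow_const _ _ (Or.inr hα'.le)))).div_const _
    have h2 := h1.tendsto.mono_left (nhdsWithin_le_nhds (s := Set.Ioi 0))
    rwa [Real.zero_rpow hα'.ne', mul_zero, mul_zero, zero_div] at h2
  obtain ⟨η, hη, hη0, hη1⟩ := ((hlim.eventually (gt_mem_nhds one_half_pos)).and
    (Ioc_mem_nhdsGT one_pos)).exists
  have hratio : ∀ x y, ‖g x / g y - 1‖ ≤ B * (H * |x - y| ^ (α : ℝ)) / c := fun x y => by
    have hgy : g y ≠ 0 := norm_pos_iff.1 (hc.trans_le (hg y))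
    have h1 := hf.dist_le x y
    rw [dist_eq_norm, Real.dist_eq] at h1
    rw [div_sub_one hgy, norm_div]
    gcongr
    · exact (hB x y).trans (by gcongr)
    · exact hg y
  refine ⟨3 / 2 * (B * H / c) + 2 * M / η ^ min (α : ℝ) (1 / 2), min (α : ℝ) (1 / 2),
    lt_min hα' one_half_pos, (min_le_right _ _).trans_lt (by norm_num), fun x y => ?_⟩
  set β := min (α : ℝ) (1 / 2) with hβ
  have hβ0 : 0 < β := lt_min hα' one_half_pos
  rw [add_mul]
  rcases le_total |x - y| η with h | h
  · have hseg : ∀ s ∈ Set.uIcc y x, ‖Complex.exp (ψ s - ψ y) - 1‖ ≤ 1 / 2 := fun s hs => by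
      rw [Complex.exp_sub, he, he]
      refine (hratio s y).trans (le_trans ?_ hη.le)
      have : |s - y| ≤ η := (Set.abs_sub_left_of_mem_uIcc hs).trans h
      gcongr
    have h1 := norm_le_of_norm_exp_sub_one_le (u := fun s => ψ s - ψ y) isPreconnected_uIcc
      (by fun_prop) hseg Set.left_mem_uIcc (by simpa using Real.pi_pos) x Set.right_mem_uIcc
    simp only [Complex.exp_sub, he] at h1
    have h2 : |x - y| ^ (α : ℝ) ≤ |x - y| ^ β := by
      rcases (abs_nonneg (x - y)).eq_or_lt with h0 | h0
      · rw [← h0, Real.zero_rpow hα'.ne', Real.zero_rpow hβ0.ne']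
      · exact Real.rpow_le_rpow_of_exponent_ge h0 (h.trans hη1) (min_le_left _ _)
    have h3 : 0 ≤ 2 * M / η ^ β * |x - y| ^ β := by positivity
    refine (h1.trans (mul_le_mul_of_nonneg_left (hratio x y) (by norm_num))).trans ?_
    have h4 : 3 / 2 * (B * (H * |x - y| ^ (α : ℝ)) / c) ≤ 3 / 2 * (B * (H * |x - y| ^ β) / c) := by
      gcongr
    have h5 : 3 / 2 * (B * (H * |x - y| ^ β) / c) = 3 / 2 * (B * H / c) * |x - y| ^ β := by ring
    linarith
  · have h1 : η ^ β ≤ |x - y| ^ β := by gcongr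
    have h2 : 0 < η ^ β := by positivity
    have h3 : 2 * M ≤ 2 * M / η ^ β * |x - y| ^ β := by
      rw [div_mul_eq_mul_div, le_div_iff₀ h2]
      gcongr
    have h4 : 0 ≤ 3 / 2 * (B * H / c) * |x - y| ^ β := by positivity
    have h5 := norm_sub_le (ψ x) (ψ y)
    linarith [hM x, hM y]

theorem exists_isAdditiveSplitting_log {f g ψ : ℝ → ℂ} {H α : ℝ≥0} (hα : 0 < α)
    (hf : HolderWith H α f) (hf2 : MemLp f 2 volume) (hψ : Continuous ψ)
    (hψl : Tendsto ψ (cocompact ℝ) (𝓝 0)) (he : ∀ t, Complex.exp (ψ t) = g t) {c B D : ℝ}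
    (hc : 0 < c) (hB0 : 0 ≤ B) (hg : ∀ t, c ≤ ‖g t‖) (hB : ∀ x y, ‖g x - g y‖ ≤ B * ‖f x - f y‖)
    (hD : ∀ t, ‖g t - 1‖ ≤ D * ‖f t‖) : ∃ ψp ψm, IsAdditiveSplitting ψ ψp ψm := by
  obtain ⟨M, -, hM⟩ := exists_norm_le_of_tendsto isClosed_univ hψ.continuousOn
    (hψl.mono_left inf_le_left)
  have hM' : ∀ t, ‖ψ t‖ ≤ M := fun t => hM t (Set.mem_univ t)
  obtain ⟨A, β, hβ, hβ1, hA⟩ := exists_holder_log hα hf hψ he hc hB0 hg hB hM'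
  exact exists_isAdditiveSplitting hψ (memLp_log hf2 hψ hψl he hD hM') hM' hβ hβ1 hA

theorem IsExtension.const_mul {U : Set ℂ} {g : ℝ → ℂ} {w : ℂ} {G : ℂ → ℂ} (h : IsExtension U g w G)
    (a : ℂ) : IsExtension U (fun t => a * g t) (a * w) (fun z => a * G z) where
  analytic := h.analytic.const_mul a
  continuous := h.continuous.const_mul a
  limit := h.limit.const_mul a
  boundary t := by rw [h.boundary]

theorem IsAdditiveSplitting.const_mul {F Fp Fm : ℝ → ℂ} (h : IsAdditiveSplitting F Fp Fm) (a : ℂ) :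
    IsAdditiveSplitting (fun t => a * F t) (fun t => a * Fp t) (fun t => a * Fm t) where
  eq_add t := by rw [h.eq_add, mul_add]
  plus := let ⟨_, hG⟩ := h.plus; ⟨_, by simpa using hG.const_mul a⟩
  minus := let ⟨_, hG⟩ := h.minus; ⟨_, by simpa using hG.const_mul a⟩

theorem IsAdditiveSplitting.exp {F Fp Fm : ℝ → ℂ} (h : IsAdditiveSplitting F Fp Fm) :
    IsWienerHopf (fun t => Complex.exp (F t)) (fun t => Complex.exp (Fp t))
      (fun t => Complex.exp (Fm t)) where
  eq_mul t := by rw [h.eq_add, Complex.exp_add]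
  plus := let ⟨_, hG⟩ := h.plus; ⟨_, hG.exp, fun _ _ => Complex.exp_ne_zero _⟩
  minus := let ⟨_, hG⟩ := h.minus; ⟨_, hG.exp, fun _ _ => Complex.exp_ne_zero _⟩

/-- Scalar factors exist as soon as the two logarithms vanishing at infinity do. -/
theorem nonempty_scalarFactors {C : ℂ} (hC : C ≠ 0) {f ψ₁ ψ₂ : ℝ → ℂ} {H α : ℝ≥0} (hα : 0 < α)
    (hf : HolderWith H α f) (hf2 : MemLp f 2 volume) {N d L : ℝ} (hd : 0 < d) (hL : 0 < L)
    (hfN : ∀ t, ‖C * f t‖ ≤ N) (hfd : ∀ t, d ≤ ‖1 + C * f t‖)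
    (hfL : ∀ t, L ≤ ‖(1 - C * f t) / (1 + C * f t)‖)
    (hψ₁ : Continuous ψ₁) (hl₁ : Tendsto ψ₁ (cocompact ℝ) (𝓝 0))
    (he₁ : ∀ t, Complex.exp (ψ₁ t) = (1 - C * f t) / (1 + C * f t))
    (hψ₂ : Continuous ψ₂) (hl₂ : Tendsto ψ₂ (cocompact ℝ) (𝓝 0))
    (he₂ : ∀ t, Complex.exp (ψ₂ t) = 1 - C ^ 2 * f t ^ 2) : Nonempty (ScalarFactors C f) := by
  have hN0 : 0 ≤ N := (norm_nonneg _).trans (hfN 0)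
  have n1 : ∀ t, 1 + C * f t ≠ 0 := fun t => norm_pos_iff.1 (hd.trans_le (hfd t))
  obtain ⟨θp, θm, hθ⟩ := exists_isAdditiveSplitting_log hα hf hf2 hψ₁ hl₁ he₁ hL
    (B := 2 * ‖C‖ / d ^ 2) (D := 2 * ‖C‖ / d) (by positivity) hfL
    (fun x y => by
      have e : (1 - C * f x) / (1 + C * f x) - (1 - C * f y) / (1 + C * f y)
          = -(2 * (C * (f x - f y))) / ((1 + C * f x) * (1 + C * f y)) := by
        have h1 := n1 x
        have h2 := n1 y
        field_simp
        ring
      rw [e, norm_div, norm_neg, norm_mul, norm_mul, norm_mul, Complex.norm_ofNat, ← mul_assoc,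
        div_mul_eq_mul_div, sq]
      gcongr
      exacts [hfd x, hfd y])
    (fun t => by
      have e : (1 - C * f t) / (1 + C * f t) - 1 = -(2 * (C * f t)) / (1 + C * f t) := by
        have h1 := n1 t
        field_simp
        ring
      rw [e, norm_div, norm_neg, norm_mul, norm_mul, Complex.norm_ofNat, ← mul_assoc,
        div_mul_eq_mul_div]
      gcongr
      exact hfd t)
  obtain ⟨lp, lm, hl⟩ := exists_isAdditiveSplitting_log hα hf hf2 hψ₂ hl₂ he₂
    -- The lower bound is read off from 1 - C²f² = ((1 - Cf)/(1 + Cf))(1 + Cf)².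
    (c := L * d * d) (B := 2 * N * ‖C‖) (D := N * ‖C‖) (by positivity) (by positivity)
    (fun t => by
      have e : 1 - C ^ 2 * f t ^ 2
          = (1 - C * f t) / (1 + C * f t) * (1 + C * f t) * (1 + C * f t) := by
        rw [div_mul_cancel₀ _ (n1 t)]; ring
      rw [e, norm_mul, norm_mul]
      gcongr
      exacts [hfL t, hfd t, hfd t])
    (fun x y => by
      have e : 1 - C ^ 2 * f x ^ 2 - (1 - C ^ 2 * f y ^ 2)
          = -((C * f x + C * f y) * (C * (f x - f y))) := by ring
      rw [e, norm_neg, norm_mul, norm_mul, ← mul_assoc]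
      gcongr
      exact (norm_add_le _ _).trans (by linarith [hfN x, hfN y]))
    (fun t => by
      have e : 1 - C ^ 2 * f t ^ 2 - 1 = -((C * f t) * (C * f t)) := by ring
      rw [e, norm_neg, norm_mul, norm_mul C, ← mul_assoc, ← norm_mul C]
      gcongr
      exact hfN t)
  -- ψ₁ is the logarithm of the reciprocal of e^(2Cθ), hence the minus sign; the factor 1/2 turns
  -- the logarithm of r² into that of r.
  have hθ' := hθ.const_mul (-(2 * C)⁻¹)
  have hl' := hl.const_mul (1 / 2)
  exact ⟨{
    r := fun t => Complex.exp (1 / 2 * ψ₂ t)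
    θ := fun t => -(2 * C)⁻¹ * ψ₁ t
    rp := _
    rm := _
    θp := _
    θm := _
    r_continuous := hl'.continuous.cexp
    r_sq := fun t => by
      rw [← he₂, ← Complex.exp_nat_mul]; congr 1; push_cast; ring
    r_limit := by simpa using (hl'.tendsto_zero.mono_left atTop_le_cocompact).cexp
    θ_continuous := hθ'.continuous
    exp_θ := fun t => by
      rw [← inv_div, ← he₁, ← Complex.exp_neg]
      congr 1
      field_simp
    θ_limit := hθ'.tendsto_zero.mono_left atTop_le_cocompact
    r_factors := hl'.exp
    θ_parts := hθ' }⟩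

theorem nonempty_scalarFactors_of_index {C : ℂ} (hC : C ≠ 0) {f f' : ℝ → ℂ} {H α : ℝ≥0}
    (hα : 0 < α) (hf : HolderWith H α f) (hf' : HolderWith H α f')
    (hl : Tendsto f (cocompact ℝ) (𝓝 0)) (hl' : Tendsto f' (cocompact ℝ) (𝓝 0))
    (hi₂ : HasIndex (fun t => 1 - C ^ 2 * f t ^ 2) 0)
    (hi₁ : HasIndex (fun t => (1 - C * f t) / (1 + C * f t)) 0)
    {N d L : ℝ} (hd : 0 < d) (hL : 0 < L)
    (hfN : ∀ t, ‖C * f t‖ ≤ N ∧ ‖C * f' t‖ ≤ N)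
    (hfd : ∀ t, d ≤ ‖1 + C * f t‖ ∧ d ≤ ‖1 + C * f' t‖)
    (hfL : ∀ t, L ≤ ‖(1 - C * f t) / (1 + C * f t)‖ ∧ L ≤ ‖(1 - C * f' t) / (1 + C * f' t)‖)
    (hs₁ : ∀ t, ‖C * f t - C * f' t‖ ≤ d ^ 2 * L / 4)
    (hs₂ : ∀ t, ‖C * f t - C * f' t‖ ≤ d ^ 2 * L / (4 * (|N| + 1)))
    (hε : L2norm (fun t => C * f t - C * f' t) < ∞) (hf2 : MemLp f 2 volume) :
    Nonempty (ScalarFactors C f) ∧ Nonempty (ScalarFactors C f') := by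
  have hN0 : 0 ≤ N := (norm_nonneg _).trans (hfN 0).1
  rw [abs_of_nonneg hN0] at hs₂
  have hfc := hf.continuous hα
  have hfc' := hf'.continuous hα
  have n1 : ∀ t, 1 + C * f t ≠ 0 := fun t => norm_pos_iff.1 (hd.trans_le (hfd t).1)
  have n2 : ∀ t, 1 + C * f' t ≠ 0 := fun t => norm_pos_iff.1 (hd.trans_le (hfd t).2)
  have hlim₁ : ∀ {f : ℝ → ℂ}, Tendsto f (cocompact ℝ) (𝓝 0) →
      Tendsto (fun t => (1 - C * f t) / (1 + C * f t)) (cocompact ℝ) (𝓝 1) := fun {f} hl => by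
    have := ((hl.const_mul C).const_sub 1).div ((hl.const_mul C).const_add 1) (by simp)
    simp only [mul_zero, sub_zero, add_zero, div_one] at this
    exact this
  have hlim₂ : ∀ {f : ℝ → ℂ}, Tendsto f (cocompact ℝ) (𝓝 0) →
      Tendsto (fun t => 1 - C ^ 2 * f t ^ 2) (cocompact ℝ) (𝓝 1) := fun {f} hl => by
    simpa using ((hl.pow 2).const_mul (C ^ 2)).const_sub 1
  obtain ⟨ψ₁, hψ₁, hl₁, he₁⟩ := hi₁.exists_log (hlim₁ hl)
  obtain ⟨ψ₂, hψ₂, hl₂, he₂⟩ := hi₂.exists_log (hlim₂ hl)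
  refine ⟨nonempty_scalarFactors hC hα hf hf2 hd hL (fun t => (hfN t).1) (fun t => (hfd t).1)
    (fun t => (hfL t).1) hψ₁ hl₁ he₁ hψ₂ hl₂ he₂, ?_⟩
  have n3 : ∀ t, 1 - C * f t ≠ 0 := fun t h => hi₁.2.1 t (by simp only [h, zero_div])
  obtain ⟨ψ₁', hψ₁', hl₁', he₁'⟩ := exists_log_of_close hψ₁ hl₁ he₁
    (g' := fun t => (1 - C * f' t) / (1 + C * f' t)) (Continuous.div (by fun_prop) (by fun_prop) n2)
    (hlim₁ hl') fun t => by
      have e : (1 - C * f' t) / (1 + C * f' t) / ((1 - C * f t) / (1 + C * f t)) - 1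
          = 2 * (C * f t - C * f' t) / ((1 + C * f t) * (1 + C * f' t) *
          ((1 - C * f t) / (1 + C * f t))) := by
        have h1 := n1 t
        have h2 := n2 t
        have h3 := n3 t
        field_simp
        ring
      rw [e, norm_div, norm_mul, norm_mul, norm_mul, Complex.norm_ofNat]
      calc _ ≤ 2 * (d ^ 2 * L / 4) / (d * d * L) := by
            gcongr
            exacts [hs₁ t, (hfd t).1, (hfd t).2, (hfL t).1]
        _ = 1 / 2 := by field_simp; norm_num
  obtain ⟨ψ₂', hψ₂', hl₂', he₂'⟩ := exists_log_of_close hψ₂ hl₂ he₂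
    (g' := fun t => 1 - C ^ 2 * f' t ^ 2) (by fun_prop) (hlim₂ hl') fun t => by
      have h0 := hi₂.2.1 t
      have e : (1 - C ^ 2 * f' t ^ 2) / (1 - C ^ 2 * f t ^ 2) - 1
          = (C * f t + C * f' t) * (C * f t - C * f' t) /
            ((1 - C * f t) / (1 + C * f t) * (1 + C * f t) * (1 + C * f t)) := by
        rw [div_sub_one h0, div_mul_cancel₀ _ (n1 t)]
        congr 1 <;> ring
      rw [e, norm_div, norm_mul, norm_mul, norm_mul]
      calc _ ≤ (2 * N) * (d ^ 2 * L / (4 * (N + 1))) / (L * d * d) := by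
            gcongr
            · exact (norm_add_le _ _).trans (by linarith [(hfN t).1, (hfN t).2])
            · exact hs₂ t
            · exact (hfL t).1
            · exact (hfd t).1
            · exact (hfd t).1
        _ = N / (N + 1) * (1 / 2) := by field_simp; ring
        _ ≤ 1 / 2 := by
            have : N / (N + 1) ≤ 1 := div_le_one_of_le₀ (by linarith) (by linarith)
            linarith
  have hdiff : MemLp (fun t => C * f t - C * f' t) 2 volume :=
    ⟨Continuous.aestronglyMeasurable (by fun_prop), hε⟩
  -- f' = f - C⁻¹(Cf - Cf') is a difference of functions in L₂.
  have hf2' : MemLp f' 2 volume := by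
    refine (hf2.sub (hdiff.const_mul C⁻¹)).ae_eq (Eventually.of_forall fun t => ?_)
    simp only [Pi.sub_apply]
    field_simp
    ring
  exact nonempty_scalarFactors hC hα hf' hf2' hd hL (fun t => (hfN t).2) (fun t => (hfd t).2)
    (fun t => (hfL t).2) hψ₁' hl₁' he₁' hψ₂' hl₂' he₂'

end DanieleKhrapkov

/-! ### Assembly of the theorem -/

theorem mainTheorem1 (k₁ k₂ C : ℂ) (hC : C ≠ 0) (hJ : C ^ 2 = k₁ * k₂)
    (α H : ℝ≥0) (hα : 0 < α) (m N d L : ℝ) (hm : 0 < m) (hd : 0 < d) (hL : 0 < L) :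
    ∃ ε₀ : ℝ, 0 < ε₀ ∧ ∀ ε : ℝ, 0 < ε → ε < ε₀ →
      ∀ f f' : ℝ → ℂ,
        HolderWith H α f → HolderWith H α f' →
        Tendsto f (cocompact ℝ) (𝓝 0) → Tendsto f' (cocompact ℝ) (𝓝 0) →
        DanieleKhrapkov.HasIndex (fun t => 1 - C ^ 2 * f t ^ 2) 0 →
        DanieleKhrapkov.HasIndex (fun t => (1 - C * f t) / (1 + C * f t)) 0 →
        (∀ t, ‖C * f t‖ ≤ N ∧ ‖C * f' t‖ ≤ N) →
        (∀ t, d ≤ ‖1 + C * f t‖ ∧ d ≤ ‖1 + C * f' t‖) →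
        (∀ t, L ≤ ‖(1 - C * f t) / (1 + C * f t)‖ ∧ L ≤ ‖(1 - C * f' t) / (1 + C * f' t)‖) →
        DanieleKhrapkov.L2norm (fun t => C * f t - C * f' t) < ENNReal.ofReal ε →
        (MemLp f 2 volume → Nonempty (DanieleKhrapkov.ScalarFactors C f) ∧
          Nonempty (DanieleKhrapkov.ScalarFactors C f')) ∧
        ∀ (F : DanieleKhrapkov.ScalarFactors C f) (F' : DanieleKhrapkov.ScalarFactors C f'),
          (∀ t, m ≤ ‖F.r t‖ ∧ m ≤ ‖F'.r t‖) →
          (∀ t, DanieleKhrapkov.dkMatrix (DanieleKhrapkov.offDiag k₁ k₂) f t =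
              F.Kp (DanieleKhrapkov.offDiag k₁ k₂) t * F.Km (DanieleKhrapkov.offDiag k₁ k₂) t) ∧
          (∀ t, DanieleKhrapkov.dkMatrix (DanieleKhrapkov.offDiag k₁ k₂) f' t =
              F'.Kp (DanieleKhrapkov.offDiag k₁ k₂) t * F'.Km (DanieleKhrapkov.offDiag k₁ k₂) t) ∧
          (∃ R E : ℝ, F.BoundR R ∧ F'.BoundR R ∧ F.BoundE E ∧ F'.BoundE E) ∧
          DanieleKhrapkov.L2norm (fun t => F.θp t - F'.θp t)
            ≤ ENNReal.ofReal (2 / (‖C‖ * d ^ 2 * L) * ε) ∧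
          DanieleKhrapkov.L2norm (fun t => F.θm t - F'.θm t)
            ≤ ENNReal.ofReal (2 / (‖C‖ * d ^ 2 * L) * ε) ∧
          ∀ R E : ℝ, F.BoundR R → F'.BoundR R → F.BoundE E → F'.BoundE E →
            DanieleKhrapkov.L2norm (fun t => F.rp t - F'.rp t)
              ≤ ENNReal.ofReal (5 * R * N / m ^ 2 * ε) ∧
            DanieleKhrapkov.L2norm (fun t => F.rm t - F'.rm t)
              ≤ ENNReal.ofReal (5 * R * N / m ^ 2 * ε) ∧
            DanieleKhrapkov.matL2norm (fun t => F.Kp (DanieleKhrapkov.offDiag k₁ k₂) t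
                - F'.Kp (DanieleKhrapkov.offDiag k₁ k₂) t)
              ≤ ENNReal.ofReal (Real.sqrt (2 + (‖k₁‖ ^ 2 + ‖k₂‖ ^ 2) / ‖C‖ ^ 2) * E *
                  (R * ‖C‖ * (2 / (‖C‖ * d ^ 2 * L)) + 5 * R * N / m ^ 2) * ε) ∧
            DanieleKhrapkov.matL2norm (fun t => F.Km (DanieleKhrapkov.offDiag k₁ k₂) t
                - F'.Km (DanieleKhrapkov.offDiag k₁ k₂) t)
              ≤ ENNReal.ofReal (Real.sqrt (2 + (‖k₁‖ ^ 2 + ‖k₂‖ ^ 2) / ‖C‖ ^ 2) * E *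
                  (R * ‖C‖ * (2 / (‖C‖ * d ^ 2 * L)) + 5 * R * N / m ^ 2) * ε) := by
  -- The first bound serves θ and the logarithm of (1 - Cf')/(1 + Cf'), the second the logarithm of
  -- 1 - C²f'², the third r. As N is fixed before f, it may be zero or negative, and |N| + 1 keeps
  -- the denominators positive.
  set δ := min (d ^ 2 * L / 4) (min (d ^ 2 * L / (4 * (|N| + 1))) (m ^ 2 / (4 * (|N| + 1)))) with hδ
  have hδ0 : 0 < δ := lt_min (by positivity) (lt_min (by positivity) (by positivity))
  obtain ⟨ε₀, hε₀, hsup⟩ := DanieleKhrapkov.exists_norm_sub_le_of_L2norm_lt C H hα hδ0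
  refine ⟨ε₀, hε₀, fun ε hε hεlt f f' hf hf' hl hl' hi₂ hi₁ hN hfd hfL hdist => ?_⟩
  have hs := hsup f f' hf hf' (hdist.trans_le (ENNReal.ofReal_le_ofReal hεlt.le))
  have hs₁ : ∀ t, ‖C * f t - C * f' t‖ ≤ d ^ 2 * L / 4 := fun t =>
    (hs t).trans (min_le_left _ _)
  have hs₂ : ∀ t, ‖C * f t - C * f' t‖ ≤ d ^ 2 * L / (4 * (|N| + 1)) := fun t =>
    (hs t).trans ((min_le_right _ _).trans (min_le_left _ _))
  have hs₃ : ∀ t, ‖C * f t - C * f' t‖ ≤ m ^ 2 / (4 * (|N| + 1)) := fun t =>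
    (hs t).trans ((min_le_right _ _).trans (min_le_right _ _))
  refine ⟨DanieleKhrapkov.nonempty_scalarFactors_of_index hC hα hf hf' hl hl' hi₂ hi₁ hd hL hN hfd
    hfL hs₁ hs₂ (hdist.trans ENNReal.ofReal_lt_top), fun F F' hr => ?_⟩
  have n1 : ∀ t, 1 + C * f t ≠ 0 := fun t => norm_pos_iff.1 (hd.trans_le (hfd t).1)
  have n1' : ∀ t, 1 + C * f' t ≠ 0 := fun t => norm_pos_iff.1 (hd.trans_le (hfd t).2)
  have n2 : ∀ t, 1 - C * f t ≠ 0 := fun t h => by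
    have := (hfL t).1
    rw [h, zero_div, norm_zero] at this
    linarith
  have n2' : ∀ t, 1 - C * f' t ≠ 0 := fun t h => by
    have := (hfL t).2
    rw [h, zero_div, norm_zero] at this
    linarith
  have hC' : 0 < ‖C‖ := norm_pos_iff.2 hC
  have hN0 : 0 ≤ N := (norm_nonneg _).trans (hN 0).1
  have hθ := DanieleKhrapkov.L2norm_le_of_norm_le_mul (by positivity)
    (F.norm_θ_sub_le hC F' hd hL hfd (fun t => (hfL t).1) hs₁) hdist.le
  have hsub := F.θ_parts.sub F'.θ_parts
  have hθp := hsub.L2norm_plus_le.trans hθ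
  have hθm := hsub.L2norm_minus_le.trans hθ
  refine ⟨F.dkMatrix_eq hC hJ n1 n2, F'.dkMatrix_eq hC hJ n1' n2', ?_, hθp, hθm,
    fun R E hR hR' hE hE' => ?_⟩
  · obtain ⟨R, E, hR, hE⟩ := F.exists_bounds
    obtain ⟨R', E', hR', hE'⟩ := F'.exists_bounds
    exact ⟨max R R', max E E',
      fun t => ⟨(hR t).1.trans (le_max_left _ _), (hR t).2.trans (le_max_left _ _)⟩,
      fun t => ⟨(hR' t).1.trans (le_max_right _ _), (hR' t).2.trans (le_max_right _ _)⟩,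
      fun t => ⟨(hE t).1.trans (le_max_left _ _), (hE t).2.trans (le_max_left _ _)⟩,
      fun t => ⟨(hE' t).1.trans (le_max_right _ _), (hE' t).2.trans (le_max_right _ _)⟩⟩
  · have hR0 : 0 ≤ R := (norm_nonneg _).trans (hR 0).1
    obtain ⟨hrp, hrm⟩ := F.L2norm_r_sub_le F' hm hN (fun t => (hr t).2) hs₃ hdist.le hR hR'
    have e : Real.sqrt (2 + (‖k₁‖ ^ 2 + ‖k₂‖ ^ 2) / ‖C‖ ^ 2) * E *
        (R * ‖C‖ * (2 / (‖C‖ * d ^ 2 * L)) + 5 * R * N / m ^ 2) * ε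
        = Real.sqrt (2 + (‖k₁‖ ^ 2 + ‖k₂‖ ^ 2) / ‖C‖ ^ 2) *
          (E * (R * ‖C‖ * (2 / (‖C‖ * d ^ 2 * L) * ε) + 5 * R * N / m ^ 2 * ε)) := by ring
    refine ⟨hrp, hrm, ?_, ?_⟩ <;> rw [e]
    · exact DanieleKhrapkov.matL2norm_dkFactor_sub_le hC F.r_factors.continuous_plus
        F'.r_factors.continuous_plus F.θ_parts.continuous_plus F'.θ_parts.continuous_plus
        (by positivity) (by positivity) (fun t => (hR t).1) (fun t => (hE t).1)
        (fun t => (hE' t).1) hθp hrp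
    · exact DanieleKhrapkov.matL2norm_dkFactor_sub_le hC F.r_factors.continuous_minus
        F'.r_factors.continuous_minus F.θ_parts.continuous_minus F'.θ_parts.continuous_minus
        (by positivity) (by positivity) (fun t => (hR t).2) (fun t => (hE t).2)
        (fun t => (hE' t).2) hθm hrm
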